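/- **Setting.** Let $\Theta\subseteq\mathbb R^p$ be convex, $\mathcal V$ a finite set, $\pi(v)\ge 0$ weights with $\sum_{v\in\mathcal V}\pi(v)=1$, and $f=\sum_{v\in\mathcal V}\pi(v)f^v$ with $f^v:\mathbb R^p\to\mathbb R$. Assume that each $f^v$ is bounded below on $\Theta$ and that the directional derivative $\nabla f^v(\theta,\theta'-\theta)=\lim_{\alpha\to0^+}\alpha^{-1}\big(f^v(\theta+\alpha(\theta'-\theta))-f^v(\theta)\big)$ exists for all $\theta,\theta'\in\Theta$. The optimality gap is $$O_f(\theta)=\sup_{\theta'\in\Theta,\ \|\theta'-\theta\|\le1}-\nabla f(\theta,\theta'-\theta),$$ and $\theta$ is a stationary point of $f$ over $\Theta$ if $O_f(\theta)=0$; here $\theta\in\Theta$, or more generally $\theta\in\overline{\Theta}$ if $\Theta$ is not closed. *Surrogates.* For $L,\mu\ge 0$, $\mathcal S_L(f^v,\theta)$ is the set of convex $g:\mathbb R^p\to\mathbb R$ with $g\ge f^v$ on $\Theta$ such that $h=g-f^v$ is differentiable, $\nabla h$ is $L$-Lipschitz, $h(\theta)=0$ and $\nabla h(\theta)=0$; $\mathcal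 S_{L,\mu}(f^v,\theta)$ is the set of its $\mu$-strongly convex members ($\mu=0$ meaning convex). *Sampling.* On a probability space, let $(v_n)_{n\ge1}$ be $\mathcal V$-valued random variables and $(\theta_n)_{n\ge0}$ the random iterates of one of the two algorithms below. Let $\mathcal F_n=\sigma(v_1,\dots,v_n,\theta_0,\dots,\theta_n)$ and $\tau_{n,v}=\inf\{j\ge1: v_{n+j}=v\}$. The only assumption on the sampling is recurrence: $\sup_{n\ge1}\|\mathbb E[\tau_{n,v}\mid\mathcal F_n]\|_\infty<\infty$ for every $v\in\mathcal V$. No independence or Markov property is assumed. *Algorithms.* Both start from a deterministic $\theta_0\in\Theta$ and initial surrogates $g_0^v$ of $f^v$ at $\theta_0$. At step $n\ge1$ a sample $v_n$ is drawn, $g_n^{v_n}$ is any surrogate of $f^{v_n}$ at $\theta_{n-1}$, $g_n^v=g_{n-1}^v$ for $v\ne v_n$, and $\bar g_n=\sum_v\pi(v)g_n^v$. - *Dynamic proximal regularization* (surrogates in $\mathcal S_{L,\mu}$, parameter $\rho\ge0$): $\theta_n\in\arg\min_{\theta\in\Theta}\big[\bar g_n(\theta)+\tfrac{\rho_n}{2}\|\theta-\theta_{n-1}\|^2\big]$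 with $\rho_n=\rho+\max_{v}(n-k^v(n))$, where $k^v(n)=\sup\{1\le j\le n: v_j=v\}$, and $k^v(n)=1$ if $v$ has not been sampled up to time $n$. - *Diminishing radius* (surrogates in $\mathcal S_{L}$, radii $(r_n)_{n\ge1}$): $\theta_n\in\arg\min\{\bar g_n(\theta):\theta\in\Theta,\ \|\theta-\theta_{n-1}\|\le r_n\}$. **Theorem 2 (Global Convergence).** Assume recurrent sampling. (i) If the iterates are produced with dynamic proximal regularization and $\rho+\mu>0$, then $O_f$ is finite on $\Theta$, $O_f(\theta_n)$ has finite second moment for every $n$, and $$\lim_{n\to\infty}\mathbb E[O_f(\theta_n)]=0,\qquad \lim_{n\to\infty}\mathbb E[O_f(\theta_n)^2]=0 .$$ (ii) If every $f^v$ is continuously differentiable with $L$-Lipschitz gradient, the radii are non-increasing with $\sum_n r_n=\infty$ and $\sum_n r_n^2<\infty$, and the iterates are produced with diminishing radius, then almost surely every limit point of $(\theta_n)$ is a stationary point of $f$ over $\Theta$. -/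

import Mathlib

open Filter Topology MeasureTheory
open scoped NNReal ENNReal

noncomputable section

namespace RMISO

/-- Parameter space `ℝ^p` with the Euclidean norm. -/
abbrev Param (p : ℕ) : Type := EuclideanSpace ℝ (Fin p)

/-- `∇f(x, d)`, the one-sided directional derivative `lim_{α → 0+} (f (x + α d) - f x) / α`. -/
def dirDeriv {p : ℕ} (f : Param p → ℝ) (x d : Param p) : ℝ :=
  limUnder (𝓝[>] (0 : ℝ)) (fun α : ℝ => (f (x + α • d) - f x) / α)

/-- The one-sided directional derivative of `f` at `x` in the direction `d` exists. -/
def HasDirDeriv {p : ℕ} (f : Param p → ℝ) (x d : Param p) : Prop :=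
  ∃ l : ℝ, Tendsto (fun α : ℝ => (f (x + α • d) - f x) / α) (𝓝[>] (0 : ℝ)) (𝓝 l)

/-- The values `-∇f(x, y - x)` over `y ∈ Θ` with `‖y - x‖ ≤ 1`. -/
def descentRates {p : ℕ} (Θ : Set (Param p)) (f : Param p → ℝ) (x : Param p) : Set ℝ :=
  {a : ℝ | ∃ y ∈ Θ, ‖y - x‖ ≤ 1 ∧ a = -dirDeriv f x (y - x)}

/-- The optimality gap `O_f(x) = sup_{y ∈ Θ, ‖y - x‖ ≤ 1} -∇f(x, y - x)`.
(As a supremum in `ℝ` it is meaningful when `descentRates Θ f x` is bounded above; this is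
asserted explicitly wherever the gap is used.) -/
def optGap {p : ℕ} (Θ : Set (Param p)) (f : Param p → ℝ) (x : Param p) : ℝ :=
  sSup (descentRates Θ f x)

/-- `x` is a stationary point of `f` over `Θ`: the supremum `O_f(x)` is finite and equal to `0`.
For closed `Θ` the first clause says `x ∈ Θ`; for a feasible set that is not closed, boundary
points are admitted. -/
def IsStationaryPoint {p : ℕ} (Θ : Set (Param p)) (f : Param p → ℝ) (x : Param p) : Prop :=
  x ∈ closure Θ ∧ BddAbove (descentRates Θ f x) ∧ optGap Θ f x = 0

/-- The set `S_L(f, x)` of first-order surrogates of `f` at `x`: convex functions `g` on `ℝ^p`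
that majorize `f` on `Θ` and whose error `g - f` is differentiable with `L`-Lipschitz gradient and
vanishes together with its gradient at `x`. -/
def surrogates {p : ℕ} (Θ : Set (Param p)) (L : ℝ≥0) (f : Param p → ℝ) (x : Param p) :
    Set (Param p → ℝ) :=
  {g | ConvexOn ℝ Set.univ g ∧ (∀ y ∈ Θ, f y ≤ g y) ∧
    Differentiable ℝ (g - f) ∧ LipschitzWith L (gradient (g - f)) ∧
    (g - f) x = 0 ∧ gradient (g - f) x = 0}

/-- The set `S_{L,μ}(f, x)` of `μ`-strongly convex first-order surrogates. -/
def strongSurrogates {p : ℕ} (Θ : Set (Param p)) (L : ℝ≥0) (μ : ℝ) (f : Param p → ℝ)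
    (x : Param p) : Set (Param p → ℝ) :=
  {g | g ∈ surrogates Θ L f x ∧ StrongConvexOn Set.univ μ g}

/-- The weighted sum `∑ᵥ f^v(x) π(v)`. -/
def weighted {p : ℕ} {V : Type*} [Fintype V] (π : V → ℝ) (f : V → Param p → ℝ) (x : Param p) :
    ℝ :=
  ∑ u, f u x * π u

/-- The return time `τ_{n,u} = inf {j ≥ 1 : v_{n+j} = u}`, infinite if there is no return. -/
def returnTime {V : Type*} (v : ℕ → V) (n : ℕ) (u : V) : ℕ∞ :=
  ⨅ (j : ℕ) (_ : 1 ≤ j ∧ v (n + j) = u), (j : ℕ∞)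

open Classical in
/-- The last passage time `k^u(n) = sup {1 ≤ j ≤ n : v_j = u}`, equal to `1` if the set is
empty. -/
def lastPassage {V : Type*} (v : ℕ → V) (n : ℕ) (u : V) : ℕ :=
  if ∃ j, 1 ≤ j ∧ j ≤ n ∧ v j = u then sSup {j | 1 ≤ j ∧ j ≤ n ∧ v j = u} else 1

/-- The dynamic regularization parameter `ρ_n = ρ + max_u (n - k^u(n))`. -/
def dynamicReg {V : Type*} [Fintype V] (ρ : ℝ) (v : ℕ → V) (n : ℕ) : ℝ :=
  ρ + ((Finset.univ.sup fun u : V => n - lastPassage v n u : ℕ) : ℝ)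

/-- `θ` and `g` are iterates and surrogates produced, along the sample sequence `v₁, v₂, …`, by
incremental majorization-minimization with dynamic proximal regularization started at `θ₀`. -/
structure IsDynamicProxRun {p : ℕ} {V : Type*} [Fintype V] (Θ : Set (Param p)) (π : V → ℝ)
    (f : V → Param p → ℝ) (L : ℝ≥0) (μ ρ : ℝ) (θ₀ : Param p)
    (v : ℕ → V) (θ : ℕ → Param p) (g : ℕ → V → Param p → ℝ) : Prop where
  init : θ 0 = θ₀
  init_mem : θ₀ ∈ Θ
  init_surrogate : ∀ u, g 0 u ∈ strongSurrogates Θ L μ (f u) θ₀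
  update : ∀ n, g (n + 1) (v (n + 1)) ∈ strongSurrogates Θ L μ (f (v (n + 1))) (θ n)
  keep : ∀ n u, u ≠ v (n + 1) → g (n + 1) u = g n u
  mem : ∀ n, θ (n + 1) ∈ Θ
  argmin : ∀ n, IsMinOn
    (fun x => weighted π (g (n + 1)) x + dynamicReg ρ v (n + 1) / 2 * ‖x - θ n‖ ^ 2)
    Θ (θ (n + 1))

/-- `θ` and `g` are iterates and surrogates produced, along the sample sequence `v₁, v₂, …`, by
incremental majorization-minimization with diminishing radii `r₁, r₂, …` started at `θ₀`. -/
structure IsDiminishingRadiusRun {p : ℕ} {V : Type*} [Fintype V] (Θ : Set (Param p)) (π : V → ℝ)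
    (f : V → Param p → ℝ) (L : ℝ≥0) (r : ℕ → ℝ) (θ₀ : Param p)
    (v : ℕ → V) (θ : ℕ → Param p) (g : ℕ → V → Param p → ℝ) : Prop where
  init : θ 0 = θ₀
  init_mem : θ₀ ∈ Θ
  init_surrogate : ∀ u, g 0 u ∈ surrogates Θ L (f u) θ₀
  update : ∀ n, g (n + 1) (v (n + 1)) ∈ surrogates Θ L (f (v (n + 1))) (θ n)
  keep : ∀ n u, u ≠ v (n + 1) → g (n + 1) u = g n u
  mem : ∀ n, θ (n + 1) ∈ Θ ∩ Metric.closedBall (θ n) (r (n + 1))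
  argmin : ∀ n, IsMinOn (weighted π (g (n + 1)))
    (Θ ∩ Metric.closedBall (θ n) (r (n + 1))) (θ (n + 1))

/-- The σ-algebra `F_n` generated by `v₁, …, v_n` and `θ₀, …, θ_n`. -/
abbrev history {p : ℕ} {Ω V : Type*} [MeasurableSpace V] (v : ℕ → Ω → V) (θ : ℕ → Ω → Param p)
    (n : ℕ) : MeasurableSpace Ω :=
  (⨆ i ∈ Set.Icc 1 n, MeasurableSpace.comap (v i) inferInstance) ⊔
    (⨆ i ∈ Set.Icc 0 n, MeasurableSpace.comap (θ i) inferInstance)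

/-- Recurrent sampling: `sup_{n ≥ 1} ‖E[τ_{n,u} | F_n]‖_∞ < ∞` for every `u`. -/
def IsRecurrent {p : ℕ} {Ω V : Type*} [MeasurableSpace Ω] [MeasurableSpace V] (P : Measure Ω)
    (v : ℕ → Ω → V) (θ : ℕ → Ω → Param p) : Prop :=
  ∀ u : V, (⨆ (n : ℕ) (_ : 1 ≤ n),
    essSup (condLExp (history v θ n) P
      (fun ω => ((returnTime (fun i => v i ω) n u : ℕ∞) : ℝ≥0∞))) P) < ∞

/-- Each `f^v` is bounded below on `Θ` and has directional derivatives along feasible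
directions. -/
def RegularOn {p : ℕ} {V : Type*} (Θ : Set (Param p)) (f : V → Param p → ℝ) : Prop :=
  ∀ u, BddBelow (f u '' Θ) ∧ ∀ x ∈ Θ, ∀ y ∈ Θ, HasDirDeriv (f u) x (y - x)

/-- Each `f^v` is continuously differentiable with `L`-Lipschitz gradient. -/
def Smooth {p : ℕ} {V : Type*} (L : ℝ≥0) (f : V → Param p → ℝ) : Prop :=
  ∀ u, ContDiff ℝ 1 (f u) ∧ LipschitzWith L (gradient (f u))

/-- The radii `r₁, r₂, …` are non-increasing, not summable and square-summable. -/
structure IsRadiusSequence (r : ℕ → ℝ) : Prop where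
  antitone : ∀ n, 1 ≤ n → r (n + 1) ≤ r n
  sum_atTop : Tendsto (fun N => ∑ n ∈ Finset.Icc 1 N, r n) atTop atTop
  sq_summable : Summable (fun n => r n ^ 2)

end RMISO

end

/-! The error between a surrogate and its function has zero gradient at the point where the
surrogate was computed, so the gradient of the averaged error at the current iterate is at most `L`
times the mean distance back to those points. The optimality gap is thus governed by the recent
steps, and the question is how far back the surrogates in use reach.

Proximal case. Comparing the new iterate with the midpoint of the step gives a descent inequality,
hence deterministic bounds on the sums of the squared steps, with and without the weight ρ_n.
First-order optimality and Cauchy–Schwarz yield O² ≤ K (m + 1) Z (`optGap_sq_le`), where m is the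
largest age and Z, the `windowEnergy`, is bounded and tends to 0 almost surely because every index
recurs. The factor m + 1 has no uniform bound, but Markov's inequality for the return time, applied
on two consecutive half-windows, gives P(m ≥ s) = O(s⁻²) uniformly in time
(`exists_measure_avoids_le`). Writing m + 1 as the sum over s of the indicators of {s ≤ m} and
dominating by these summable tails gives E[(m + 1) Z] → 0.

Radius case. Testing the minimizer against a move of relative length r along a feasible direction
bounds r O by the decrease of the surrogate value, plus r times the error gradient, plus 2 L r²
(`radius_mul_optGap_le`). After exchanging sums, the error terms are dominated by sums of r_i² times
return times, finite almost surely since return times have bounded mean. So the sum of r O is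
finite. Near a non-stationary limit point, lower semicontinuity keeps O above a positive constant;
the iterates then cannot afford the path length needed to leave, and staying contradicts the
divergence of the sum of radii (`false_of_mapClusterPt_of_summable`). -/

noncomputable section

namespace RMISO

/-! ### Last passage and return times along one sample path -/

section Passage

variable {V : Type*} {v : ℕ → V} {n : ℕ} {u : V}

lemma lastPassage_zero : lastPassage v 0 u = 1 := by
  unfold lastPassage
  rw [if_neg]
  rintro ⟨j, h1, h2, -⟩
  omega

lemma lastPassage_succ_of_eq (h : v (n + 1) = u) : lastPassage v (n + 1) u = n + 1 := by
  unfold lastPassage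
  rw [if_pos ⟨n + 1, by omega, le_rfl, h⟩]
  have : IsGreatest {j | 1 ≤ j ∧ j ≤ n + 1 ∧ v j = u} (n + 1) :=
    ⟨⟨by omega, le_rfl, h⟩, fun j hj => hj.2.1⟩
  exact this.csSup_eq

lemma lastPassage_succ_of_ne (h : v (n + 1) ≠ u) :
    lastPassage v (n + 1) u = lastPassage v n u := by
  have key : ∀ j, (1 ≤ j ∧ j ≤ n + 1 ∧ v j = u) ↔ (1 ≤ j ∧ j ≤ n ∧ v j = u) := by
    intro j
    constructor
    · rintro ⟨h1, h2, h3⟩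
      refine ⟨h1, ?_, h3⟩
      rcases Nat.lt_or_ge n j with hj | hj
      · obtain rfl : j = n + 1 := by omega
        exact absurd h3 h
      · exact hj
    · rintro ⟨h1, h2, h3⟩
      exact ⟨h1, by omega, h3⟩
  have hset : {j | 1 ≤ j ∧ j ≤ n + 1 ∧ v j = u} = {j | 1 ≤ j ∧ j ≤ n ∧ v j = u} := Set.ext key
  unfold lastPassage
  rw [hset]
  classical exact if_congr (exists_congr key) rfl rfl

lemma one_le_lastPassage : 1 ≤ lastPassage v n u := by
  induction n with
  | zero => rw [lastPassage_zero]
  | succ n ih =>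
    by_cases h : v (n + 1) = u
    · rw [lastPassage_succ_of_eq h]; omega
    · rwa [lastPassage_succ_of_ne h]

lemma lastPassage_succ_le : lastPassage v (n + 1) u ≤ n + 1 := by
  induction n with
  | zero =>
    by_cases h : v (0 + 1) = u
    · rw [lastPassage_succ_of_eq h]
    · rw [lastPassage_succ_of_ne h, lastPassage_zero]
  | succ n ih =>
    by_cases h : v (n + 1 + 1) = u
    · rw [lastPassage_succ_of_eq h]
    · rw [lastPassage_succ_of_ne h]; omega

lemma ne_of_lastPassage_lt {j : ℕ} (h : lastPassage v n u < j) (hj : j ≤ n) : v j ≠ u := by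
  induction n with
  | zero => rw [lastPassage_zero] at h; omega
  | succ n ih =>
    by_cases hv : v (n + 1) = u
    · rw [lastPassage_succ_of_eq hv] at h; omega
    · rw [lastPassage_succ_of_ne hv] at h
      rcases Nat.lt_or_ge n j with hj' | hj'
      · obtain rfl : j = n + 1 := by omega
        exact hv
      · exact ih h hj'

lemma succ_le_returnTime {s : ℕ} (h : ∀ i, 1 ≤ i → i ≤ s → v (n + i) ≠ u) :
    ((s + 1 : ℕ) : ℕ∞) ≤ returnTime v n u := by
  refine le_iInf₂ fun j hj => ?_
  rw [Nat.cast_le]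
  by_contra hlt
  exact h j hj.1 (by omega) hj.2

lemma exists_of_returnTime_ne_top (h : returnTime v n u ≠ ⊤) : ∃ j, 1 ≤ j ∧ v (n + j) = u := by
  by_contra hne
  push Not at hne
  refine h ?_
  simp only [returnTime, iInf_eq_top]
  intro j hj
  exact absurd hj.2 (hne j hj.1)

/-- The largest age `max_u (n - k^u(n))` of the surrogates in use at time `n`. -/
def maxAge [Fintype V] (v : ℕ → V) (n : ℕ) : ℕ :=
  Finset.univ.sup fun u : V => n - lastPassage v n u

lemma dynamicReg_eq [Fintype V] (ρ : ℝ) : dynamicReg ρ v n = ρ + maxAge v n := rfl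

lemma sub_lastPassage_le_maxAge [Fintype V] (u : V) : n - lastPassage v n u ≤ maxAge v n :=
  Finset.le_sup (f := fun u : V => n - lastPassage v n u) (Finset.mem_univ u)

lemma maxAge_succ_le [Fintype V] : maxAge v (n + 1) ≤ n := by
  refine Finset.sup_le fun u _ => ?_
  have := one_le_lastPassage (v := v) (n := n + 1) (u := u)
  omega

lemma exists_maxAge_eq [Fintype V] [Nonempty V] (v : ℕ → V) (n : ℕ) :
    ∃ u, maxAge v n = n - lastPassage v n u := by
  obtain ⟨u, -, hu⟩ := Finset.exists_mem_eq_sup Finset.univ Finset.univ_nonempty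
    (fun u : V => n - lastPassage v n u)
  exact ⟨u, hu⟩

/-- If every index is sampled infinitely often, the oldest surrogate in use gets arbitrarily
recent. -/
lemma tendsto_sub_maxAge [Fintype V] [Nonempty V] (h : ∀ u N, ∃ j, N ≤ j ∧ v j = u) :
    Tendsto (fun n => n - maxAge v n) atTop atTop := by
  refine tendsto_atTop.2 fun b => ?_
  choose j hj hv using fun u => h u (b + 1)
  filter_upwards [eventually_ge_atTop (Finset.univ.sup j)] with n hn
  obtain ⟨u, hu⟩ := exists_maxAge_eq v n
  have hju : j u ≤ n := (Finset.le_sup (Finset.mem_univ u)).trans hn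
  have h1 : j u ≤ lastPassage v n u := by
    by_contra hlt
    exact ne_of_lastPassage_lt (not_le.1 hlt) hju (hv u)
  have := hj u
  omega

end Passage

/-! ### Consequences of recurrence: tails of ages, finiteness of return times -/

section Sampling

variable {p : ℕ} {Ω V : Type*} {v : ℕ → Ω → V}

/-- The event that `u` is not sampled at the times `n + 1, …, n + s`. -/
def avoids (v : ℕ → Ω → V) (u : V) (n s : ℕ) : Set Ω :=
  {ω | ∀ i, 1 ≤ i → i ≤ s → v (n + i) ω ≠ u}

lemma avoids_add_subset (u : V) (n s t : ℕ) :
    avoids v u n (s + t) ⊆ avoids v u n s ∩ avoids v u (n + s) t := by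
  intro ω h
  refine ⟨fun i h1 h2 => h i h1 (by omega), fun i h1 h2 => ?_⟩
  rw [add_assoc]
  exact h (s + i) (by omega) (by omega)

/-- Turns a statement about the past into one about the future of time `n + 1 - s`. The clause `s ≤
n` makes that time at least 1, as the recurrence hypothesis requires. -/
lemma le_maxAge_subset [Fintype V] [Nonempty V] (n s : ℕ) :
    {ω | s ≤ maxAge (fun i => v i ω) (n + 1)} ⊆
      {ω | s ≤ n ∧ ∃ u, ω ∈ avoids v u (n + 1 - s) s} := by
  intro ω h
  have hs : s ≤ maxAge (fun i => v i ω) (n + 1) := h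
  refine ⟨hs.trans maxAge_succ_le, ?_⟩
  obtain ⟨u, hu⟩ := exists_maxAge_eq (fun i => v i ω) (n + 1)
  rw [hu] at hs
  have h1 := one_le_lastPassage (v := fun i => v i ω) (n := n + 1) (u := u)
  have h2 := lastPassage_succ_le (v := fun i => v i ω) (n := n) (u := u)
  exact ⟨u, fun i hi1 hi2 => ne_of_lastPassage_lt (v := fun i => v i ω) (n := n + 1) (u := u)
    (by omega) (by omega)⟩

/-- Markov's inequality localized to `A`: avoiding `u` for `s` steps forces the return time to be at
least `s + 1`. -/
lemma measure_inter_avoids_le [MeasurableSpace Ω] {P : Measure Ω} {M : ℝ≥0} {u : V} {n s : ℕ} {A : Set Ω}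
    (hA : ∫⁻ ω in A, ((returnTime (fun i => v i ω) n u : ℕ∞) : ℝ≥0∞) ∂P ≤ M * P A)
    (hm : MeasurableSet (avoids v u n s)) :
    ((s + 1 : ℕ) : ℝ≥0∞) * P (A ∩ avoids v u n s) ≤ M * P A := by
  refine le_trans ?_ hA
  calc ((s + 1 : ℕ) : ℝ≥0∞) * P (A ∩ avoids v u n s)
      = ∫⁻ ω in A ∩ avoids v u n s, ((s + 1 : ℕ) : ℝ≥0∞) ∂P := by rw [setLIntegral_const]
    _ ≤ ∫⁻ ω in A ∩ avoids v u n s, ((returnTime (fun i => v i ω) n u : ℕ∞) : ℝ≥0∞) ∂P := by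
        rw [Set.inter_comm, ← Measure.restrict_restrict hm]
        refine lintegral_mono_ae ?_
        filter_upwards [ae_restrict_mem hm] with ω hω
        have := succ_le_returnTime (v := fun i => v i ω) hω
        calc ((s + 1 : ℕ) : ℝ≥0∞) = (((s + 1 : ℕ) : ℕ∞) : ℝ≥0∞) := by simp
          _ ≤ _ := ENat.toENNReal_le.2 this
    _ ≤ _ := lintegral_mono_set Set.inter_subset_left

variable [MeasurableSpace V] {θ : ℕ → Ω → Param p}

lemma measurableSet_avoids_history [MeasurableSingletonClass V] (u : V) (n s : ℕ) :
    MeasurableSet[history v θ (n + s)] (avoids v u n s) := by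
  have : avoids v u n s = ⋂ i, ⋂ (_ : 1 ≤ i), ⋂ (_ : i ≤ s), v (n + i) ⁻¹' {u}ᶜ := by
    ext ω; simp [avoids]
  rw [this]
  refine MeasurableSet.iInter fun i => MeasurableSet.iInter fun h1 => MeasurableSet.iInter
    fun h2 => ?_
  have hle : MeasurableSpace.comap (v (n + i)) inferInstance ≤ history v θ (n + s) :=
    (le_iSup₂_of_le (f := fun j (_ : j ∈ Set.Icc 1 (n + s)) =>
      MeasurableSpace.comap (v j) inferInstance) (n + i) ⟨by omega, by omega⟩ le_rfl).trans
      le_sup_left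
  exact hle _ ⟨{u}ᶜ, (measurableSet_singleton u).compl, rfl⟩

variable [MeasurableSpace Ω]

lemma history_le (hv : ∀ n, Measurable (v n)) (hθ : ∀ n, Measurable (θ n)) (n : ℕ) :
    history v θ n ≤ ‹MeasurableSpace Ω› :=
  sup_le (iSup₂_le fun i _ => (hv i).comap_le) (iSup₂_le fun i _ => (hθ i).comap_le)

lemma measurable_lastPassage [MeasurableSingletonClass V] (hv : ∀ n, Measurable (v n)) (u : V)
    (n : ℕ) : Measurable fun ω => lastPassage (fun i => v i ω) n u := by
  induction n with
  | zero => simp only [lastPassage_zero]; exact measurable_const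
  | succ n ih =>
    classical
    have : (fun ω => lastPassage (fun i => v i ω) (n + 1) u) = fun ω =>
        if v (n + 1) ω = u then n + 1 else lastPassage (fun i => v i ω) n u := by
      ext ω
      split_ifs with h
      · exact lastPassage_succ_of_eq h
      · exact lastPassage_succ_of_ne h
    rw [this]
    exact Measurable.ite (hv (n + 1) (measurableSet_singleton u)) measurable_const ih

lemma measurable_maxAge [Fintype V] [MeasurableSingletonClass V] (hv : ∀ n, Measurable (v n))
    (n : ℕ) : Measurable fun ω => maxAge (fun i => v i ω) n := by
  have : (fun ω => maxAge (fun i => v i ω) n) =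
      Finset.univ.sup fun u : V => fun ω => n - lastPassage (fun i => v i ω) n u := by
    ext ω; simp [maxAge, Finset.sup_apply]
  rw [this]
  refine Finset.sup_induction (p := fun h : Ω → ℕ => Measurable h) measurable_const
    (fun _ h₁ _ h₂ => h₁.sup h₂) fun u _ => ?_
  exact (measurable_from_top (f := fun k : ℕ => n - k)).comp (measurable_lastPassage hv u n)

variable {P : Measure Ω} [IsProbabilityMeasure P]

lemma IsRecurrent.exists_setLIntegral_le (hrec : IsRecurrent P v θ) (hv : ∀ n, Measurable (v n))
    (hθ : ∀ n, Measurable (θ n)) (u : V) :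
    ∃ M : ℝ≥0, ∀ n, 1 ≤ n → ∀ A, MeasurableSet[history v θ n] A →
      ∫⁻ ω in A, ((returnTime (fun i => v i ω) n u : ℕ∞) : ℝ≥0∞) ∂P ≤ M * P A := by
  obtain ⟨M, hM⟩ := ENNReal.lt_iff_exists_coe.1 (hrec u)
  refine ⟨M, fun n hn A hA => ?_⟩
  rw [← setLIntegral_condLExp (history_le hv hθ n) P _ hA, ← setLIntegral_const]
  refine lintegral_mono_ae (ae_restrict_of_ae ?_)
  filter_upwards [ENNReal.ae_le_essSup (condLExp (history v θ n) P
      (fun ω => ((returnTime (fun i => v i ω) n u : ℕ∞) : ℝ≥0∞)))] with ω hω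
  refine hω.trans ?_
  rw [← hM.1]
  exact le_iSup₂ (f := fun (n : ℕ) (_ : 1 ≤ n) => essSup (condLExp (history v θ n) P
      (fun ω => ((returnTime (fun i => v i ω) n u : ℕ∞) : ℝ≥0∞))) P) n hn

lemma IsRecurrent.exists_measure_avoids_le [MeasurableSingletonClass V]
    (hrec : IsRecurrent P v θ) (hv : ∀ n, Measurable (v n))
    (hθ : ∀ n, Measurable (θ n)) (u : V) :
    ∃ K : ℝ, 0 ≤ K ∧ ∀ n, 1 ≤ n → ∀ s, P.real (avoids v u n s) ≤ K / ((s : ℝ) + 1) ^ 2 := by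
  obtain ⟨M, hM⟩ := hrec.exists_setLIntegral_le hv hθ u
  have hmeas : ∀ n s, MeasurableSet (avoids v u n s) := fun n s =>
    history_le hv hθ _ _ (measurableSet_avoids_history u n s)
  have key : ∀ n, 1 ≤ n → ∀ A, MeasurableSet[history v θ n] A → ∀ s : ℕ,
      ((s : ℝ) + 1) * P.real (A ∩ avoids v u n s) ≤ M * P.real A := by
    intro n hn A hA s
    have h := measure_inter_avoids_le (s := s) (hM n hn A hA) (hmeas n s)
    have h' := ENNReal.toReal_mono (by finiteness) h
    rw [ENNReal.toReal_mul, ENNReal.toReal_mul, ENNReal.toReal_natCast] at h'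
    push_cast at h'
    exact h'
  -- Split the window into two halves of length `t = s / 2`. Avoidance on the first half is known at
  -- time `n + t`, so Markov's inequality applies again there; each half contributes `M / (t + 1)`,
  -- and `s + 1 ≤ 2 (t + 1)` produces the 4. A single use would only give the non-summable rate 1/s.
  refine ⟨4 * M ^ 2, by positivity, fun n hn s => ?_⟩
  set t := s / 2 with ht
  have h1 : P.real (avoids v u n s) ≤ P.real (avoids v u n t ∩ avoids v u (n + t) t) := by
    refine measureReal_mono (Set.Subset.trans ?_ (avoids_add_subset u n t t))
    intro ω h i hi1 hi2
    exact h i hi1 (by omega)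
  have h2 := key (n + t) (by omega) _ (measurableSet_avoids_history u n t) t
  have h3 := key n hn Set.univ MeasurableSet.univ t
  rw [Set.univ_inter, probReal_univ, mul_one] at h3
  have ht' : (s : ℝ) + 1 ≤ 2 * ((t : ℝ) + 1) := by
    have : s + 1 ≤ 2 * (t + 1) := by omega
    exact_mod_cast this
  rw [le_div_iff₀ (by positivity)]
  have hM0 : (0 : ℝ) ≤ M := M.2
  have hs0 : (0 : ℝ) ≤ s := Nat.cast_nonneg s
  have ht0 : (0 : ℝ) ≤ t := Nat.cast_nonneg t
  calc P.real (avoids v u n s) * ((s : ℝ) + 1) ^ 2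
      ≤ P.real (avoids v u n t ∩ avoids v u (n + t) t) * (2 * ((t : ℝ) + 1)) ^ 2 := by
        gcongr
    _ = 4 * ((t + 1) * ((t + 1) * P.real (avoids v u n t ∩ avoids v u (n + t) t))) := by ring
    _ ≤ 4 * ((t + 1) * (M * P.real (avoids v u n t))) := by gcongr
    _ = 4 * (M * ((t + 1) * P.real (avoids v u n t))) := by ring
    _ ≤ 4 * (M * M) := by gcongr
    _ = 4 * (M : ℝ) ^ 2 := by ring

/-- The age of the oldest surrogate has summable tails, uniformly in time. -/
lemma IsRecurrent.exists_summable_tail [Fintype V] [Nonempty V] [MeasurableSingletonClass V]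
    (hrec : IsRecurrent P v θ) (hv : ∀ n, Measurable (v n)) (hθ : ∀ n, Measurable (θ n)) :
    ∃ q : ℕ → ℝ, Summable q ∧
      ∀ n s, P.real {ω | s ≤ maxAge (fun i => v i ω) (n + 1)} ≤ q s := by
  choose K hK0 hK using hrec.exists_measure_avoids_le hv hθ
  refine ⟨fun s => (∑ u, K u) / ((s : ℝ) + 1) ^ 2, ?_, fun n s => ?_⟩
  · have := ((summable_nat_add_iff 1).2 (Real.summable_one_div_nat_pow.2 one_lt_two)).mul_left
      (∑ u, K u)
    refine this.congr fun s => ?_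
    push_cast
    rw [mul_one_div]
  · by_cases hs : s ≤ n
    · have hsub : {ω | s ≤ maxAge (fun i => v i ω) (n + 1)} ⊆
          ⋃ u, avoids v u (n + 1 - s) s := fun ω h => by
        obtain ⟨-, u, hu⟩ := le_maxAge_subset n s h
        exact Set.mem_iUnion.2 ⟨u, hu⟩
      refine (measureReal_mono hsub).trans ((measureReal_iUnion_fintype_le _).trans ?_)
      refine le_trans ?_ (Finset.sum_div _ _ _).ge
      exact Finset.sum_le_sum fun u _ => hK u _ (by omega) s
    · have : {ω | s ≤ maxAge (fun i => v i ω) (n + 1)} = ∅ := by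
        ext ω
        simp only [Set.mem_ofPred_eq, Set.mem_empty_iff_false, iff_false]
        exact fun h => hs (le_maxAge_subset n s h).1
      rw [this, measureReal_empty]
      exact div_nonneg (Finset.sum_nonneg fun u _ => hK0 u) (by positivity)

lemma measurable_returnTime [MeasurableSingletonClass V] (hv : ∀ n, Measurable (v n)) (n : ℕ)
    (u : V) : Measurable fun ω => ((returnTime (fun i => v i ω) n u : ℕ∞) : ℝ≥0∞) := by
  classical
  have : (fun ω => ((returnTime (fun i => v i ω) n u : ℕ∞) : ℝ≥0∞)) = fun ω =>
      ⨅ j : ℕ, if 1 ≤ j ∧ v (n + j) ω = u then (j : ℝ≥0∞) else ⊤ := by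
    ext ω
    simp only [returnTime, ENat.toENNReal_iInf, ENat.toENNReal_coe]
    congr 1
    ext j
    rw [iInf_eq_if]
  rw [this]
  refine Measurable.iInf fun j => Measurable.ite ?_ measurable_const measurable_const
  exact MeasurableSet.inter (MeasurableSet.const _) (hv (n + j) (measurableSet_singleton u))

lemma IsRecurrent.ae_returnTime_ne_top [Countable V] [MeasurableSingletonClass V]
    (hrec : IsRecurrent P v θ) (hv : ∀ n, Measurable (v n)) (hθ : ∀ n, Measurable (θ n)) :
    ∀ᵐ ω ∂P, ∀ u n, 1 ≤ n → returnTime (fun i => v i ω) n u ≠ ⊤ := by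
  rw [ae_all_iff]
  intro u
  obtain ⟨M, hM⟩ := hrec.exists_setLIntegral_le hv hθ u
  rw [ae_all_iff]
  intro n
  by_cases hn : 1 ≤ n
  · have h := hM n hn Set.univ MeasurableSet.univ
    rw [setLIntegral_univ, measure_univ, mul_one] at h
    have := ae_lt_top (measurable_returnTime hv n u) (h.trans_lt ENNReal.coe_lt_top).ne
    filter_upwards [this] with ω hω _ htop
    simp [htop] at hω
  · exact ae_of_all _ fun ω h => absurd h hn

lemma IsRecurrent.ae_frequently [Countable V] [MeasurableSingletonClass V]
    (hrec : IsRecurrent P v θ) (hv : ∀ n, Measurable (v n)) (hθ : ∀ n, Measurable (θ n)) :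
    ∀ᵐ ω ∂P, ∀ u N, ∃ j, N ≤ j ∧ v j ω = u := by
  filter_upwards [hrec.ae_returnTime_ne_top hv hθ] with ω hω u N
  obtain ⟨j, -, hj⟩ := exists_of_returnTime_ne_top (hω u (N + 1) (by omega))
  exact ⟨N + 1 + j, by omega, hj⟩

/-- Almost surely, return times are summable against any summable weight. -/
lemma IsRecurrent.ae_summable_returnTime [Countable V] [MeasurableSingletonClass V]
    (hrec : IsRecurrent P v θ) (hv : ∀ n, Measurable (v n)) (hθ : ∀ n, Measurable (θ n))
    {a : ℕ → ℝ} (ha0 : ∀ n, 0 ≤ a n) (ha : Summable a) :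
    ∀ᵐ ω ∂P, ∀ u, Summable fun n =>
      a n * ((returnTime (fun i => v i ω) (n + 1) u).toNat : ℝ) := by
  rw [ae_all_iff]
  intro u
  obtain ⟨M, hM⟩ := hrec.exists_setLIntegral_le hv hθ u
  -- By Tonelli the expected weighted sum is at most `M` times the sum of `a`, so the series is
  -- finite almost surely; `toNat` loses nothing because return times are almost surely finite.
  have hint : ∫⁻ ω, ∑' n, ENNReal.ofReal (a n) *
      ((returnTime (fun i => v i ω) (n + 1) u : ℕ∞) : ℝ≥0∞) ∂P ≠ ∞ := by
    rw [lintegral_tsum fun n => ((measurable_returnTime hv _ u).const_mul _).aemeasurable]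
    have hle : ∀ n, ∫⁻ ω, ENNReal.ofReal (a n) *
        ((returnTime (fun i => v i ω) (n + 1) u : ℕ∞) : ℝ≥0∞) ∂P ≤ ENNReal.ofReal (a n) * M := by
      intro n
      rw [lintegral_const_mul _ (measurable_returnTime hv _ u)]
      have h := hM (n + 1) (by omega) Set.univ MeasurableSet.univ
      rw [setLIntegral_univ, measure_univ, mul_one] at h
      gcongr
    refine ne_top_of_le_ne_top ?_ (ENNReal.tsum_le_tsum hle)
    rw [ENNReal.tsum_mul_right]
    exact ENNReal.mul_ne_top ha.tsum_ofReal_ne_top ENNReal.coe_ne_top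
  filter_upwards [ae_lt_top (Measurable.tsum fun n =>
    (measurable_returnTime hv _ u).const_mul _) hint, hrec.ae_returnTime_ne_top hv hθ]
    with ω hω htop
  refine (ENNReal.summable_toReal hω.ne).congr fun n => ?_
  rw [ENNReal.toReal_mul, ENNReal.toReal_ofReal (ha0 n)]
  lift returnTime (fun i => v i ω) (n + 1) u to ℕ using htop u (n + 1) (by omega) with k
  simp

end Sampling

/-! ### Functions with Lipschitz gradient -/

section Smooth

variable {p : ℕ} {h : Param p → ℝ} {L : ℝ≥0}

lemma hasFDerivAt_of_differentiable (hd : Differentiable ℝ h) (x : Param p) :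
    HasFDerivAt h (InnerProductSpace.toDual ℝ (Param p) (gradient h x)) x :=
  (hd x).hasGradientAt

/-- The first-order Taylor estimate for a function with Lipschitz gradient. -/
lemma abs_sub_sub_inner_le (hd : Differentiable ℝ h) (hL : LipschitzWith L (gradient h))
    (x d : Param p) : |h (x + d) - h x - inner ℝ (gradient h x) d| ≤ L * ‖d‖ ^ 2 := by
  -- The mean value inequality on the ball of radius `‖d‖` gives the constant `L` instead of the
  -- sharp `L / 2`, which is enough here.
  have key := (convex_closedBall x ‖d‖).norm_image_sub_le_of_norm_hasFDerivWithin_le'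
    (f := h) (C := L * ‖d‖) (x := x) (y := x + d)
    (φ := InnerProductSpace.toDual ℝ (Param p) (gradient h x))
    (fun z _ => (hasFDerivAt_of_differentiable hd z).hasFDerivWithinAt)
    (fun z hz => by
      rw [← map_sub, LinearIsometryEquiv.norm_map]
      refine (hL.norm_sub_le z x).trans ?_
      rw [mem_closedBall_iff_norm] at hz
      gcongr) (Metric.mem_closedBall_self (norm_nonneg _)) (by simp)
  rw [add_sub_cancel_left, InnerProductSpace.toDual_apply_apply, Real.norm_eq_abs] at key
  calc _ ≤ _ := key
    _ = _ := by ring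

lemma tendsto_slope_of_differentiable (hd : Differentiable ℝ h) (x d : Param p) :
    Tendsto (fun α : ℝ => (h (x + α • d) - h x) / α) (𝓝[>] (0 : ℝ))
      (𝓝 (inner ℝ (gradient h x) d)) := by
  have h1 : HasDerivAt (fun α : ℝ => x + α • d) d 0 := by
    simpa using ((hasDerivAt_id (0 : ℝ)).smul_const d).const_add x
  have h2 : HasFDerivAt h (InnerProductSpace.toDual ℝ (Param p) (gradient h x))
      (x + (0 : ℝ) • d) := by
    rw [zero_smul, add_zero]
    exact hasFDerivAt_of_differentiable hd x
  have h3 := (h2.comp_hasDerivAt (0 : ℝ) h1).tendsto_slope_zero_right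
  rw [InnerProductSpace.toDual_apply_apply] at h3
  refine h3.congr fun α => ?_
  simp [div_eq_inv_mul]

lemma hasDirDeriv_of_differentiable (hd : Differentiable ℝ h) (x d : Param p) :
    HasDirDeriv h x d :=
  ⟨_, tendsto_slope_of_differentiable hd x d⟩

lemma dirDeriv_eq_inner (hd : Differentiable ℝ h) (x d : Param p) :
    dirDeriv h x d = inner ℝ (gradient h x) d :=
  (tendsto_slope_of_differentiable hd x d).limUnder_eq

end Smooth

/-! ### Weighted averages of functions and surrogates -/

section Weighted

variable {p : ℕ} {V : Type*} [Fintype V] {π : V → ℝ}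

lemma weighted_sub (f g : V → Param p → ℝ) :
    weighted π g - weighted π f = weighted π fun u => g u - f u := by
  ext x
  simp [weighted, sub_mul]

lemma weighted_le (hπ : ∀ u, 0 ≤ π u) {f g : V → Param p → ℝ} {x : Param p}
    (h : ∀ u, f u x ≤ g u x) : weighted π f x ≤ weighted π g x :=
  Finset.sum_le_sum fun u _ => mul_le_mul_of_nonneg_right (h u) (hπ u)

lemma hasGradientAt_weighted {h : V → Param p → ℝ} (hd : ∀ u, Differentiable ℝ (h u))
    (x : Param p) : HasGradientAt (weighted π h) (∑ u, π u • gradient (h u) x) x := by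
  rw [hasGradientAt_iff_hasFDerivAt]
  have := HasFDerivAt.fun_sum (u := Finset.univ) fun u (_ : u ∈ Finset.univ) =>
    (hasFDerivAt_of_differentiable (hd u) x).mul_const (π u)
  have h2 : InnerProductSpace.toDual ℝ (Param p) (∑ u, π u • gradient (h u) x) =
      ∑ u, π u • InnerProductSpace.toDual ℝ (Param p) (gradient (h u) x) := by
    simp [map_sum]
  rw [h2]
  exact this

lemma differentiable_weighted {h : V → Param p → ℝ} (hd : ∀ u, Differentiable ℝ (h u)) :
    Differentiable ℝ (weighted π h) := fun x => (hasGradientAt_weighted hd x).differentiableAt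

lemma gradient_weighted {h : V → Param p → ℝ} (hd : ∀ u, Differentiable ℝ (h u)) (x : Param p) :
    gradient (weighted π h) x = ∑ u, π u • gradient (h u) x :=
  (hasGradientAt_weighted hd x).gradient

lemma lipschitzWith_gradient_weighted (hπ : ∀ u, 0 ≤ π u) (hπ1 : ∑ u, π u = 1)
    {h : V → Param p → ℝ} {L : ℝ≥0} (hd : ∀ u, Differentiable ℝ (h u))
    (hL : ∀ u, LipschitzWith L (gradient (h u))) :
    LipschitzWith L (gradient (weighted π h)) := by
  refine LipschitzWith.of_dist_le_mul fun x y => ?_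
  rw [dist_eq_norm, gradient_weighted hd, gradient_weighted hd, ← Finset.sum_sub_distrib]
  calc ‖∑ u, (π u • gradient (h u) x - π u • gradient (h u) y)‖
      ≤ ∑ u, π u * (L * dist x y) := by
        refine norm_sum_le_of_le _ fun u _ => ?_
        rw [← smul_sub, norm_smul, Real.norm_of_nonneg (hπ u), ← dist_eq_norm]
        exact mul_le_mul_of_nonneg_left ((hL u).dist_le_mul x y) (hπ u)
    _ = L * dist x y := by rw [← Finset.sum_mul, hπ1, one_mul]

lemma HasDirDeriv.weighted {f : V → Param p → ℝ} {x d : Param p}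
    (h : ∀ u, HasDirDeriv (f u) x d) : HasDirDeriv (weighted π f) x d := by
  choose l hl using h
  refine ⟨∑ u, l u * π u, ?_⟩
  refine (tendsto_finsetSum Finset.univ fun u _ => (hl u).mul_const (π u)).congr fun α => ?_
  simp only [RMISO.weighted, ← Finset.sum_sub_distrib, Finset.sum_div]
  exact Finset.sum_congr rfl fun u _ => by ring

lemma convexOn_weighted (hπ : ∀ u, 0 ≤ π u) {g : V → Param p → ℝ}
    (hg : ∀ u, ConvexOn ℝ Set.univ (g u)) : ConvexOn ℝ Set.univ (weighted π g) := by
  refine ⟨convex_univ, fun x _ y _ a b ha hb hab => ?_⟩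
  simp only [weighted, smul_eq_mul, Finset.mul_sum, ← Finset.sum_add_distrib]
  refine Finset.sum_le_sum fun u _ => ?_
  have := mul_le_mul_of_nonneg_right
    ((hg u).2 (Set.mem_univ x) (Set.mem_univ y) ha hb hab) (hπ u)
  simp only [smul_eq_mul] at this
  linarith

lemma strongConvexOn_weighted (hπ : ∀ u, 0 ≤ π u) (hπ1 : ∑ u, π u = 1) {μ : ℝ}
    {g : V → Param p → ℝ} (hg : ∀ u, StrongConvexOn Set.univ μ (g u)) :
    StrongConvexOn Set.univ μ (weighted π g) := by
  refine ⟨convex_univ, fun x _ y _ a b ha hb hab => ?_⟩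
  have key : ∑ u, (a * b * (μ / 2 * ‖x - y‖ ^ 2)) * π u = a * b * (μ / 2 * ‖x - y‖ ^ 2) := by
    rw [← Finset.mul_sum, hπ1, mul_one]
  dsimp only
  rw [← key]
  simp only [weighted, smul_eq_mul, Finset.mul_sum, ← Finset.sum_add_distrib,
    ← Finset.sum_sub_distrib]
  refine Finset.sum_le_sum fun u _ => ?_
  have := mul_le_mul_of_nonneg_right
    ((hg u).2 (Set.mem_univ x) (Set.mem_univ y) ha hb hab) (hπ u)
  simp only [smul_eq_mul] at this
  linarith

variable {Θ : Set (Param p)} {L : ℝ≥0} {f g : V → Param p → ℝ} {x : V → Param p}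

lemma norm_gradient_weighted_sub_le (hπ : ∀ u, 0 ≤ π u)
    (hg : ∀ u, g u ∈ surrogates Θ L (f u) (x u)) (y : Param p) :
    ‖gradient (weighted π g - weighted π f) y‖ ≤ L * ∑ u, π u * dist y (x u) := by
  rw [weighted_sub, gradient_weighted fun u => (hg u).2.2.1, Finset.mul_sum]
  refine norm_sum_le_of_le _ fun u _ => ?_
  obtain ⟨-, -, -, hL, -, h0⟩ := hg u
  rw [norm_smul, Real.norm_of_nonneg (hπ u)]
  have := hL.dist_le_mul y (x u)
  rw [dist_eq_norm, h0, sub_zero] at this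
  calc π u * _ ≤ π u * (L * dist y (x u)) := mul_le_mul_of_nonneg_left this (hπ u)
    _ = _ := by ring

lemma weighted_mem_surrogates (hπ : ∀ u, 0 ≤ π u) (hπ1 : ∑ u, π u = 1) {x₀ : Param p}
    (hg : ∀ u, g u ∈ surrogates Θ L (f u) x₀) :
    weighted π g ∈ surrogates Θ L (weighted π f) x₀ := by
  refine ⟨convexOn_weighted hπ fun u => (hg u).1, fun y hy => weighted_le hπ fun u =>
    (hg u).2.1 y hy, ?_, ?_, ?_, ?_⟩
  · rw [weighted_sub]
    exact differentiable_weighted fun u => (hg u).2.2.1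
  · rw [weighted_sub]
    exact lipschitzWith_gradient_weighted hπ hπ1 (fun u => (hg u).2.2.1)
      fun u => (hg u).2.2.2.1
  · rw [weighted_sub]
    refine Finset.sum_eq_zero fun u _ => ?_
    exact mul_eq_zero_of_left (hg u).2.2.2.2.1 _
  · have := norm_gradient_weighted_sub_le hπ hg x₀
    simpa using this

end Weighted

/-! ### Finiteness, lower semicontinuity and measurability of the gap -/

section OptGap

variable {p : ℕ} {Θ : Set (Param p)} {f g : Param p → ℝ} {L : ℝ≥0} {x₀ x y d : Param p}

lemma HasDirDeriv.tendsto (h : HasDirDeriv f x d) :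
    Tendsto (fun α : ℝ => (f (x + α • d) - f x) / α) (𝓝[>] (0 : ℝ)) (𝓝 (dirDeriv f x d)) :=
  tendsto_nhds_limUnder h

lemma HasDirDeriv.dirDeriv_smul (h : HasDirDeriv f x d) {c : ℝ} (hc : 0 < c) :
    dirDeriv f x (c • d) = c * dirDeriv f x d := by
  have h1 : Tendsto (fun α : ℝ => α * c) (𝓝[>] (0 : ℝ)) (𝓝[>] (0 : ℝ)) := by
    refine tendsto_nhdsWithin_iff.2 ⟨?_, ?_⟩
    · have : Tendsto (fun α : ℝ => α * c) (𝓝 0) (𝓝 (0 * c)) :=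
        (continuous_id.mul continuous_const).tendsto 0
      rw [zero_mul] at this
      exact this.mono_left nhdsWithin_le_nhds
    · filter_upwards [self_mem_nhdsWithin] with α hα
      exact mul_pos hα hc
  have h2 := (h.tendsto.comp h1).const_mul c
  refine Tendsto.limUnder_eq (h2.congr fun α => ?_)
  rcases eq_or_ne α 0 with rfl | hα
  · simp
  · simp only [Function.comp, smul_smul]
    field_simp

lemma dirDeriv_zero_right : dirDeriv f x 0 = 0 := by
  refine Tendsto.limUnder_eq ?_
  simp

/-- The difference of the slopes of a surrogate and of the function. -/
lemma tendsto_slope_surrogate (hg : g ∈ surrogates Θ L f x₀) (h : HasDirDeriv f x d) :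
    Tendsto (fun α : ℝ => (g (x + α • d) - g x) / α) (𝓝[>] (0 : ℝ))
      (𝓝 (dirDeriv f x d + inner ℝ (gradient (g - f) x) d)) := by
  refine (h.tendsto.add (tendsto_slope_of_differentiable hg.2.2.1 x d)).congr fun α => ?_
  simp only [Pi.sub_apply]
  ring

lemma continuous_of_mem_surrogates (hg : g ∈ surrogates Θ L f x₀) : Continuous g :=
  hg.1.locallyLipschitz.continuous

/-- Slopes of a convex function increase with the step, so the directional derivative of `g` lies
below every secant slope. For fixed `t` the right side is continuous in `x`, which is the source of
the lower semicontinuity of the gap. -/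
lemma dirDeriv_add_inner_le (hg : g ∈ surrogates Θ L f x₀) (h : HasDirDeriv f x d) {t : ℝ}
    (ht : 0 < t) :
    dirDeriv f x d + inner ℝ (gradient (g - f) x) d ≤ (g (x + t • d) - g x) / t := by
  refine le_of_tendsto (tendsto_slope_surrogate hg h) ?_
  filter_upwards [Ioo_mem_nhdsGT ht] with α hα
  have key := hg.1.2 (Set.mem_univ x) (Set.mem_univ (x + t • d))
    (sub_nonneg.2 (div_le_one_of_le₀ hα.2.le ht.le)) (div_nonneg hα.1.le ht.le)
    (sub_add_cancel 1 (α / t))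
  have hpt : (1 - α / t) • x + (α / t) • (x + t • d) = x + α • d := by
    rw [smul_add, smul_smul, div_mul_cancel₀ _ ht.ne', sub_smul, one_smul]
    abel
  rw [hpt, smul_eq_mul, smul_eq_mul] at key
  rw [div_le_div_iff₀ hα.1 ht]
  have h2 := mul_le_mul_of_nonneg_right key ht.le
  have h3 : ((1 - α / t) * g x + α / t * g (x + t • d)) * t =
      t * g x - α * g x + α * g (x + t • d) := by
    field_simp
  rw [h3] at h2
  linarith

/-- The forward slope of the convex `g` is at least its backward secant slope. The point `x - d` may
leave `Θ`, but `g` is convex on the whole space; the bound is continuous in `d`, hence bounded on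
the unit ball. -/
lemma neg_dirDeriv_le (hg : g ∈ surrogates Θ L f x₀) (h : HasDirDeriv f x d) :
    -dirDeriv f x d ≤ g (x - d) - g x + inner ℝ (gradient (g - f) x) d := by
  have : g x - g (x - d) ≤ dirDeriv f x d + inner ℝ (gradient (g - f) x) d := by
    refine ge_of_tendsto (tendsto_slope_surrogate hg h) ?_
    filter_upwards [self_mem_nhdsWithin] with α hα
    have hα0 : (0 : ℝ) < α := hα
    have key := hg.1.2 (Set.mem_univ (x + α • d)) (Set.mem_univ (x - d))
      (by positivity : 0 ≤ 1 / (1 + α)) (by positivity : 0 ≤ α / (1 + α)) (by field_simp)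
    have hpt : (1 / (1 + α)) • (x + α • d) + (α / (1 + α)) • (x - d) = x := by
      have h1 : (1 + α) * (1 / (1 + α)) = 1 := by field_simp
      have h2 : (1 + α) * (α / (1 + α)) = α := by field_simp
      have h3 : (1 + α) • ((1 / (1 + α)) • (x + α • d) + (α / (1 + α)) • (x - d)) =
          (1 + α) • x := by
        rw [smul_add, smul_smul, smul_smul, h1, h2]
        module
      exact smul_right_injective _ (by positivity : (1 + α) ≠ 0) h3
    rw [hpt, smul_eq_mul, smul_eq_mul] at key
    rw [le_div_iff₀ hα0]
    have h2 := mul_le_mul_of_nonneg_right key (by positivity : 0 ≤ 1 + α)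
    have h3 : (1 / (1 + α) * g (x + α • d) + α / (1 + α) * g (x - d)) * (1 + α) =
        g (x + α • d) + α * g (x - d) := by
      field_simp
    rw [h3] at h2
    linarith
  linarith

lemma bddAbove_descentRates (hg : g ∈ surrogates Θ L f x₀)
    (h : ∀ y ∈ Θ, HasDirDeriv f x (y - x)) : BddAbove (descentRates Θ f x) := by
  have hcont : Continuous fun d : Param p =>
      g (x - d) - g x + inner ℝ (gradient (g - f) x) d := by
    have := continuous_of_mem_surrogates hg
    fun_prop
  obtain ⟨C, hC⟩ := ((isCompact_closedBall (0 : Param p) 1).image hcont).bddAbove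
  refine ⟨C, ?_⟩
  rintro a ⟨y, hy, hyx, rfl⟩
  exact (neg_dirDeriv_le hg (h y hy)).trans
    (hC ⟨y - x, by simpa using hyx, rfl⟩)

lemma optGap_nonneg (hg : g ∈ surrogates Θ L f x₀) (hx : x ∈ Θ)
    (h : ∀ y ∈ Θ, HasDirDeriv f x (y - x)) : 0 ≤ optGap Θ f x :=
  le_csSup (bddAbove_descentRates hg h)
    ⟨x, hx, by simp, by rw [sub_self, dirDeriv_zero_right, neg_zero]⟩

lemma optGap_le {C : ℝ} (hx : x ∈ Θ)
    (h : ∀ y ∈ Θ, ‖y - x‖ ≤ 1 → -dirDeriv f x (y - x) ≤ C) : optGap Θ f x ≤ C := by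
  refine csSup_le ⟨_, x, hx, by simp, rfl⟩ ?_
  rintro a ⟨y, hy, hyx, rfl⟩
  exact h y hy hyx

/-- Lower semicontinuity of the optimality gap along the feasible set. -/
lemma eventually_lt_optGap (hΘ : Convex ℝ Θ) (hg : g ∈ surrogates Θ L f x₀)
    (hdir : ∀ x ∈ Θ, ∀ y ∈ Θ, HasDirDeriv f x (y - x)) (hy : y ∈ Θ) (hyx : ‖y - x‖ ≤ 1)
    (h : HasDirDeriv f x (y - x)) {a : ℝ} (ha : a < -dirDeriv f x (y - x)) :
    ∀ᶠ z in 𝓝[Θ] x, a < optGap Θ f z := by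
  set H := gradient (g - f) with hH
  have hHc : Continuous H := hg.2.2.2.1.continuous
  have hgc := continuous_of_mem_surrogates hg
  have hlim : ∀ᶠ t in 𝓝[>] (0 : ℝ),
      a < -((g (x + t • (y - x)) - g x) / t - inner ℝ (H x) (y - x)) := by
    have := ((tendsto_slope_surrogate hg h).sub_const (inner ℝ (H x) (y - x))).neg
    rw [add_sub_cancel_right] at this
    exact this.eventually_const_lt ha
  obtain ⟨t, hta, ht⟩ := (hlim.and self_mem_nhdsWithin).exists
  have ht0 : (0 : ℝ) < t := ht
  -- When `x` is replaced by a nearby `z`, the direction `y - z` may become longer than 1, so it is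
  -- rescaled to an admissible one; the factor tends to 1 as `z` tends to `x`.
  have hcont : Continuous fun z : Param p => (max 1 ‖y - z‖)⁻¹ *
      -((g (z + t • (y - z)) - g z) / t - inner ℝ (H z) (y - z)) := by
    refine Continuous.mul (Continuous.inv₀ (by fun_prop) fun z => ?_) (by fun_prop)
    exact (lt_max_of_lt_left one_pos).ne'
  have hx : a < (max 1 ‖y - x‖)⁻¹ *
      -((g (x + t • (y - x)) - g x) / t - inner ℝ (H x) (y - x)) := by
    rw [max_eq_left hyx, inv_one, one_mul]
    exact hta
  filter_upwards [nhdsWithin_le_nhds (hcont.tendsto x |>.eventually_const_lt hx),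
    self_mem_nhdsWithin] with z hz hzΘ
  set c : ℝ := (max 1 ‖y - z‖)⁻¹ with hc
  have hm : 0 < max 1 ‖y - z‖ := lt_max_of_lt_left one_pos
  have hc0 : 0 < c := inv_pos.2 hm
  have hc1 : c ≤ 1 := inv_le_one_of_one_le₀ (le_max_left _ _)
  have hmem : z + c • (y - z) ∈ Θ := hΘ.add_smul_sub_mem hzΘ hy ⟨hc0.le, hc1⟩
  have hrate : c * -dirDeriv f z (y - z) ≤ optGap Θ f z := by
    refine le_csSup (bddAbove_descentRates hg (hdir z hzΘ)) ⟨z + c • (y - z), hmem, ?_, ?_⟩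
    · rw [add_sub_cancel_left, norm_smul, Real.norm_of_nonneg hc0.le, hc, inv_mul_le_iff₀ hm,
        mul_one]
      exact le_max_right _ _
    · rw [add_sub_cancel_left, (hdir z hzΘ y hy).dirDeriv_smul hc0]
      ring
  have hle := dirDeriv_add_inner_le hg (hdir z hzΘ y hy) ht0
  refine hz.trans_le (le_trans ?_ hrate)
  refine mul_le_mul_of_nonneg_left ?_ hc0.le
  linarith

/-- A convex set need not be Borel, and the gap is controlled only on `Θ`. Its superlevel sets are
traces on `Θ` of open sets, so preimages under `X` are measurable up to null sets. -/
lemma aemeasurable_optGap_comp {Ω : Type*} [MeasurableSpace Ω] {P : Measure Ω}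
    (hΘ : Convex ℝ Θ) (hg : g ∈ surrogates Θ L f x₀)
    (hdir : ∀ x ∈ Θ, ∀ y ∈ Θ, HasDirDeriv f x (y - x)) {X : Ω → Param p} (hX : Measurable X)
    (hXΘ : ∀ᵐ ω ∂P, X ω ∈ Θ) : AEMeasurable (fun ω => optGap Θ f (X ω)) P := by
  refine NullMeasurable.aemeasurable ?_
  suffices Measurable (fun ω => optGap Θ f (X ω) : NullMeasurableSpace Ω P → ℝ) from this
  refine measurable_of_Ioi fun a => ?_
  obtain ⟨U, hU, hUa⟩ : ∃ U : Set (Param p), IsOpen U ∧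
      ∀ x ∈ Θ, x ∈ U ↔ a < optGap Θ f x := by
    refine ⟨interior {x | x ∈ Θ → a < optGap Θ f x}, isOpen_interior, fun x hx =>
      ⟨fun h => interior_subset h hx, fun h => ?_⟩⟩
    obtain ⟨-, ⟨y, hy, hyx, rfl⟩, hb⟩ := exists_lt_of_lt_csSup
      (s := descentRates Θ f x) ⟨_, x, hx, by simp, rfl⟩ h
    have := eventually_lt_optGap hΘ hg hdir hy hyx (hdir x hx y hy) hb
    rw [eventually_nhdsWithin_iff] at this
    exact mem_interior_iff_mem_nhds.2 this
  have h1 : NullMeasurableSet (X ⁻¹' U) P := (hX hU.measurableSet).nullMeasurableSet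
  refine h1.congr ?_
  filter_upwards [hXΘ] with ω hω
  exact propext (hUa _ hω)

end OptGap

/-! ### Limits of expectations weighted by ages -/

section Tail

variable {Ω : Type*} [MeasurableSpace Ω] {P : Measure Ω} [IsProbabilityMeasure P]

/-- A bounded sequence tending to zero almost surely still tends to zero in mean when weighted by
integer variables with uniformly summable tails. -/
lemma tendsto_integral_mul_of_summable_tail {m : ℕ → Ω → ℕ} {Z : ℕ → Ω → ℝ} {C : ℝ} {q : ℕ → ℝ}
    (hm : ∀ n, Measurable (m n)) (hmn : ∀ n ω, m n ω ≤ n) (hZ : ∀ n, Measurable (Z n))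
    (hZC : ∀ n, ∀ᵐ ω ∂P, ‖Z n ω‖ ≤ C)
    (hlim : ∀ᵐ ω ∂P, Tendsto (fun n => Z n ω) atTop (𝓝 0)) (hq : Summable q)
    (htail : ∀ n s, P.real {ω | s ≤ m n ω} ≤ q s) :
    Tendsto (fun n => ∫ ω, ((m n ω : ℝ) + 1) * Z n ω ∂P) atTop (𝓝 0) := by
  have hC : 0 ≤ C := by
    obtain ⟨ω, hω⟩ := (hZC 0).exists
    exact (norm_nonneg _).trans hω
  have hint : ∀ n, Integrable (Z n) P := fun n =>
    Integrable.of_bound (hZ n).aestronglyMeasurable C (hZC n)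
  have hset : ∀ n s, MeasurableSet {ω | s ≤ m n ω} := fun n s =>
    measurableSet_le measurable_const (hm n)
  -- The number of `s` with `0 ≤ s ≤ m` is `m + 1`; since `m n ≤ n`, only finitely many terms of the
  -- series are nonzero.
  have hsum : ∀ n, ∫ ω, ((m n ω : ℝ) + 1) * Z n ω ∂P =
      ∑' s, ∫ ω in {ω | s ≤ m n ω}, Z n ω ∂P := by
    intro n
    have hzero : ∀ s ∉ Finset.range (n + 1), ∫ ω in {ω | s ≤ m n ω}, Z n ω ∂P = 0 := by
      intro s hs
      have : {ω | s ≤ m n ω} = ∅ := by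
        ext ω
        have := hmn n ω
        have := Finset.mem_range.not.1 hs
        simp only [Set.mem_ofPred_eq, Set.mem_empty_iff_false, iff_false]
        omega
      rw [this, setIntegral_empty]
    rw [tsum_eq_sum hzero]
    simp_rw [← integral_indicator (hset n _)]
    rw [← integral_finsetSum _ fun s _ => (hint n).indicator (hset n s)]
    refine integral_congr_ae (ae_of_all _ fun ω => ?_)
    have hf : (Finset.range (n + 1)).filter (fun s => s ≤ m n ω) = Finset.range (m n ω + 1) := by
      ext s
      have := hmn n ω
      simp only [Finset.mem_filter, Finset.mem_range]
      omega
    simp only [Set.indicator_apply, Set.mem_ofPred_eq]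
    rw [← Finset.sum_filter, hf, Finset.sum_const, Finset.card_range, nsmul_eq_mul]
    push_cast
    ring
  have hterm : ∀ s, Tendsto (fun n => ∫ ω in {ω | s ≤ m n ω}, Z n ω ∂P) atTop (𝓝 0) := by
    intro s
    have h1 : Tendsto (fun n => ∫ ω, ‖Z n ω‖ ∂P) atTop (𝓝 (∫ _, (0 : ℝ) ∂P)) := by
      refine tendsto_integral_of_dominated_convergence (fun _ => C)
        (fun n => (hZ n).norm.aestronglyMeasurable) (integrable_const C) (fun n => ?_) ?_
      · filter_upwards [hZC n] with ω hω
        rwa [norm_norm]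
      · filter_upwards [hlim] with ω hω
        simpa using hω.norm
    rw [integral_zero] at h1
    refine squeeze_zero_norm (fun n => ?_) h1
    exact (norm_integral_le_integral_norm _).trans
      (setIntegral_le_integral (hint n).norm (ae_of_all _ fun ω => norm_nonneg _))
  have := tendsto_tsum_of_dominated_convergence (hq.mul_left C) hterm
    (Eventually.of_forall fun n s => by
      refine (norm_setIntegral_le_of_norm_le_const_ae (measure_lt_top _ _)
        (ae_restrict_of_ae (hZC n))).trans ?_
      exact mul_le_mul_of_nonneg_left (htail n s) hC)
  rw [tsum_zero] at this
  exact this.congr fun n => (hsum n).symm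

end Tail

/-! ### Facts common to both algorithms -/

section Descent

variable {p : ℕ} {V : Type*} [Fintype V] {Θ : Set (Param p)} {π : V → ℝ}
  {f : V → Param p → ℝ} {L : ℝ≥0} {v : ℕ → V} {θ : ℕ → Param p} {g : ℕ → V → Param p → ℝ}

/-- At `θ n` the fresh surrogate equals its function, which the surrogate it replaces majorizes. -/
lemma weighted_update_le (hπ : ∀ u, 0 ≤ π u) {n : ℕ} {x : V → Param p} (hθ : θ n ∈ Θ)
    (hold : ∀ u, g n u ∈ surrogates Θ L (f u) (x u))
    (hup : g (n + 1) (v (n + 1)) ∈ surrogates Θ L (f (v (n + 1))) (θ n))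
    (hkeep : ∀ u, u ≠ v (n + 1) → g (n + 1) u = g n u) :
    weighted π (g (n + 1)) (θ n) ≤ weighted π (g n) (θ n) := by
  refine weighted_le hπ fun u => ?_
  by_cases hu : u = v (n + 1)
  · subst hu
    have h0 : g (n + 1) (v (n + 1)) (θ n) - f (v (n + 1)) (θ n) = 0 := hup.2.2.2.2.1
    rw [sub_eq_zero.1 h0]
    exact (hold _).2.1 _ hθ
  · rw [hkeep u hu]

lemma RegularOn.exists_lowerBound (hf : RegularOn Θ f) (hπ : ∀ u, 0 ≤ π u) :
    ∃ B, ∀ x ∈ Θ, B ≤ weighted π f x := by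
  choose b hb using fun u => (hf u).1
  exact ⟨∑ u, b u * π u, fun x hx => Finset.sum_le_sum fun u _ =>
    mul_le_mul_of_nonneg_right (hb u ⟨x, hx, rfl⟩) (hπ u)⟩

lemma RegularOn.hasDirDeriv_weighted (hf : RegularOn Θ f) :
    ∀ x ∈ Θ, ∀ y ∈ Θ, HasDirDeriv (weighted π f) x (y - x) :=
  fun x hx y hy => HasDirDeriv.weighted fun u => (hf u).2 x hx y hy

lemma weighted_eq_of_mem_surrogates (h : ∀ u, g 0 u ∈ surrogates Θ L (f u) (θ 0)) :
    weighted π (g 0) (θ 0) = weighted π f (θ 0) := by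
  refine Finset.sum_congr rfl fun u _ => ?_
  have h0 : g 0 u (θ 0) - f u (θ 0) = 0 := (h u).2.2.2.2.1
  rw [sub_eq_zero.1 h0]

end Descent

/-! ### Dynamic proximal regularization: pathwise estimates -/

section DynamicProx

variable {p : ℕ} {V : Type*} [Fintype V] {Θ : Set (Param p)} {π : V → ℝ}
  {f : V → Param p → ℝ} {L : ℝ≥0} {μ ρ : ℝ} {θ₀ : Param p}
  {v : ℕ → V} {θ : ℕ → Param p} {g : ℕ → V → Param p → ℝ}

namespace IsDynamicProxRun

lemma mem_feasible (h : IsDynamicProxRun Θ π f L μ ρ θ₀ v θ g) (n : ℕ) : θ n ∈ Θ := by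
  cases n with
  | zero => rw [h.init]; exact h.init_mem
  | succ n => exact h.mem n

/-- A surrogate drawn at time `k` is based at `θ (k - 1)`; the default last passage 1 makes this
index 0 for an index not yet sampled, matching the initial surrogate. -/
lemma mem_strongSurrogates (h : IsDynamicProxRun Θ π f L μ ρ θ₀ v θ g) (n : ℕ) (u : V) :
    g n u ∈ strongSurrogates Θ L μ (f u) (θ (lastPassage v n u - 1)) := by
  induction n with
  | zero =>
    rw [lastPassage_zero, Nat.sub_self, h.init]
    exact h.init_surrogate u
  | succ n ih =>
    by_cases hu : v (n + 1) = u
    · rw [lastPassage_succ_of_eq hu, Nat.add_sub_cancel, ← hu]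
      exact h.update n
    · rw [lastPassage_succ_of_ne hu, h.keep n u (Ne.symm hu)]
      exact ih

lemma descent (h : IsDynamicProxRun Θ π f L μ ρ θ₀ v θ g) (hΘ : Convex ℝ Θ)
    (hπ : ∀ u, 0 ≤ π u) (hπ1 : ∑ u, π u = 1) (hρ : 0 ≤ ρ) (n : ℕ) :
    weighted π (g (n + 1)) (θ (n + 1)) +
        (μ + dynamicReg ρ v (n + 1)) / 4 * dist (θ n) (θ (n + 1)) ^ 2 ≤
      weighted π (g n) (θ n) := by
  refine le_trans ?_ (weighted_update_le hπ (h.mem_feasible n)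
    (fun u => (h.mem_strongSurrogates n u).1) (h.update n).1 (h.keep n))
  set R := dynamicReg ρ v (n + 1) with hR
  have hR0 : 0 ≤ R := by rw [hR, dynamicReg_eq]; positivity
  have hsc := strongConvexOn_weighted hπ hπ1 fun u => (h.mem_strongSurrogates (n + 1) u).2
  -- With the midpoint as competitor, strong convexity yields μ/4 and the proximal term 3R/4; only
  -- R/4 of the latter is kept.
  have hmid := hsc.2 (Set.mem_univ (θ (n + 1))) (Set.mem_univ (θ n))
    (by norm_num : (0 : ℝ) ≤ 1 / 2) (by norm_num : (0 : ℝ) ≤ 1 / 2) (by norm_num)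
  have hmin := h.argmin n (hΘ (h.mem n) (h.mem_feasible n) (by norm_num : (0 : ℝ) ≤ 1 / 2)
    (by norm_num : (0 : ℝ) ≤ 1 / 2) (by norm_num))
  simp only [Set.mem_ofPred_eq] at hmin
  have hpt : (1 / 2 : ℝ) • θ (n + 1) + (1 / 2 : ℝ) • θ n - θ n =
      (1 / 2 : ℝ) • (θ (n + 1) - θ n) := by module
  rw [hpt, norm_smul, Real.norm_of_nonneg (by norm_num)] at hmin
  simp only [smul_eq_mul] at hmid
  rw [dist_comm, dist_eq_norm]
  have := mul_nonneg hR0 (sq_nonneg ‖θ (n + 1) - θ n‖)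
  nlinarith [hmid, hmin]

lemma sum_le (h : IsDynamicProxRun Θ π f L μ ρ θ₀ v θ g) (hΘ : Convex ℝ Θ)
    (hπ : ∀ u, 0 ≤ π u) (hπ1 : ∑ u, π u = 1) (hρ : 0 ≤ ρ) {B : ℝ}
    (hB : ∀ x ∈ Θ, B ≤ weighted π f x) (N : ℕ) :
    ∑ n ∈ Finset.range N, (μ + dynamicReg ρ v (n + 1)) * dist (θ n) (θ (n + 1)) ^ 2 ≤
      4 * (weighted π f θ₀ - B) := by
  have key : ∀ N, weighted π (g N) (θ N) + ∑ n ∈ Finset.range N,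
      (μ + dynamicReg ρ v (n + 1)) / 4 * dist (θ n) (θ (n + 1)) ^ 2 ≤ weighted π f θ₀ := by
    intro N
    induction N with
    | zero =>
      rw [Finset.sum_range_zero, add_zero, weighted_eq_of_mem_surrogates (f := f) (Θ := Θ) (L := L),
        h.init]
      intro u
      rw [h.init]
      exact (h.init_surrogate u).1
    | succ N ih =>
      rw [Finset.sum_range_succ]
      linarith [h.descent hΘ hπ hπ1 hρ N]
  have h1 : B ≤ weighted π (g N) (θ N) := (hB _ (h.mem_feasible N)).trans
    (weighted_le hπ fun u => (h.mem_strongSurrogates N u).1.2.1 _ (h.mem_feasible N))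
  have h2 : ∑ n ∈ Finset.range N, (μ + dynamicReg ρ v (n + 1)) * dist (θ n) (θ (n + 1)) ^ 2 =
      4 * ∑ n ∈ Finset.range N,
        (μ + dynamicReg ρ v (n + 1)) / 4 * dist (θ n) (θ (n + 1)) ^ 2 := by
    rw [Finset.mul_sum]
    exact Finset.sum_congr rfl fun n _ => by ring
  rw [h2]
  linarith [key N]

/-- First-order optimality: compare `θ (n + 1)` with `θ (n + 1) + α • d`, divide by `α` and let `α`
tend to 0. -/
lemma optGap_le_gradient (h : IsDynamicProxRun Θ π f L μ ρ θ₀ v θ g) (hΘ : Convex ℝ Θ)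
    (hρ : 0 ≤ ρ) (hdir : ∀ x ∈ Θ, ∀ y ∈ Θ, HasDirDeriv (weighted π f) x (y - x)) (n : ℕ) :
    optGap Θ (weighted π f) (θ (n + 1)) ≤ dynamicReg ρ v (n + 1) * dist (θ n) (θ (n + 1)) +
      ‖gradient (weighted π (g (n + 1)) - weighted π f) (θ (n + 1))‖ := by
  refine optGap_le (h.mem n) fun y hy hyx => ?_
  set R := dynamicReg ρ v (n + 1) with hR
  have hR0 : 0 ≤ R := by rw [hR, dynamicReg_eq]; positivity
  set F := weighted π f
  set G := weighted π (g (n + 1)) with hG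
  set x := θ (n + 1) with hx
  set d := y - x with hd
  have hdiff : Differentiable ℝ (G - F) := by
    rw [hG, weighted_sub]
    exact differentiable_weighted fun u => (h.mem_strongSurrogates (n + 1) u).1.2.2.1
  have hF := hdir x (h.mem n) y hy
  have hlimit : Tendsto (fun α : ℝ => -(((G - F) (x + α • d) - (G - F) x) / α) -
      R * (inner ℝ (x - θ n) d + α / 2 * ‖d‖ ^ 2)) (𝓝[>] (0 : ℝ))
      (𝓝 (-inner ℝ (gradient (G - F) x) d - R * (inner ℝ (x - θ n) d + 0 / 2 * ‖d‖ ^ 2))) := by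
    refine (tendsto_slope_of_differentiable hdiff x d).neg.sub (Tendsto.mono_left ?_
      (nhdsWithin_le_nhds (s := Set.Ioi (0 : ℝ))))
    exact Continuous.tendsto (by fun_prop : Continuous fun α : ℝ =>
      R * (inner ℝ (x - θ n) d + α / 2 * ‖d‖ ^ 2)) 0
  have hle := le_of_tendsto_of_tendsto hlimit hF.tendsto (by
    filter_upwards [Ioo_mem_nhdsGT (one_pos (α := ℝ))] with α hα
    have hmem : x + α • d ∈ Θ := hΘ.add_smul_sub_mem (h.mem n) hy ⟨hα.1.le, hα.2.le⟩
    have hmin := h.argmin n hmem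
    simp only [Set.mem_ofPred_eq] at hmin
    have hpt : x + α • d - θ n = (x - θ n) + α • d := by abel
    rw [hpt, norm_add_sq_real, inner_smul_right, norm_smul, Real.norm_of_nonneg hα.1.le] at hmin
    have hα0 := hα.1
    rw [le_div_iff₀ hα0, sub_mul, neg_mul, div_mul_cancel₀ _ hα0.ne']
    simp only [Pi.sub_apply]
    nlinarith [hmin])
  rw [zero_div, zero_mul, add_zero] at hle
  have hd1 : ‖d‖ ≤ 1 := hyx
  have h1 : inner ℝ (gradient (G - F) x) d ≤ ‖gradient (G - F) x‖ :=
    (real_inner_le_norm _ _).trans (mul_le_of_le_one_right (norm_nonneg _) hd1)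
  have h2 : inner ℝ (x - θ n) d ≤ dist (θ n) x := by
    rw [dist_comm, dist_eq_norm]
    exact (real_inner_le_norm _ _).trans (mul_le_of_le_one_right (norm_nonneg _) hd1)
  have h3 := mul_le_mul_of_nonneg_left h2 hR0
  linarith

end IsDynamicProxRun

/-- The regularized step energy at time `n + 1` plus the energy of all steps made since the oldest
surrogate in use was computed. -/
def windowEnergy (ρ : ℝ) (v : ℕ → V) (θ : ℕ → Param p) (n : ℕ) : ℝ :=
  dynamicReg ρ v (n + 1) * dist (θ n) (θ (n + 1)) ^ 2 +
    ∑ i ∈ Finset.Ico (n - maxAge v (n + 1)) (n + 1), dist (θ i) (θ (i + 1)) ^ 2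

lemma dist_lastPassage_le (θ : ℕ → Param p) (n : ℕ) (u : V) :
    dist (θ (n + 1)) (θ (lastPassage v (n + 1) u - 1)) ≤
      ∑ i ∈ Finset.Ico (n - maxAge v (n + 1)) (n + 1), dist (θ i) (θ (i + 1)) := by
  have h1 := one_le_lastPassage (v := v) (n := n + 1) (u := u)
  have h2 := lastPassage_succ_le (v := v) (n := n) (u := u)
  have h3 := sub_lastPassage_le_maxAge (v := v) (n := n + 1) u
  rw [dist_comm]
  refine (dist_le_Ico_sum_dist θ (by omega)).trans ?_
  exact Finset.sum_le_sum_of_subset_of_nonneg (Finset.Ico_subset_Ico_left (by omega))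
    fun _ _ _ => dist_nonneg

lemma windowEnergy_nonneg (hρ : 0 ≤ ρ) (n : ℕ) : 0 ≤ windowEnergy ρ v θ n := by
  unfold windowEnergy
  rw [dynamicReg_eq]
  positivity

lemma measurable_windowEnergy {Ω : Type*} [MeasurableSpace Ω] [MeasurableSpace V]
    [MeasurableSingletonClass V] {v : ℕ → Ω → V} {θ : ℕ → Ω → Param p}
    (hv : ∀ n, Measurable (v n)) (hθ : ∀ n, Measurable (θ n)) (n : ℕ) :
    Measurable fun ω => windowEnergy ρ (fun i => v i ω) (fun i => θ i ω) n := by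
  have hm := measurable_maxAge hv (n + 1)
  have hmR : Measurable fun ω => (maxAge (fun i => v i ω) (n + 1) : ℝ) :=
    (measurable_from_top (f := fun k : ℕ => (k : ℝ))).comp hm
  have hdist : ∀ i, Measurable fun ω => dist (θ i ω) (θ (i + 1) ω) ^ 2 := fun i =>
    ((hθ i).dist (hθ (i + 1))).pow_const 2
  have : (fun ω => windowEnergy ρ (fun i => v i ω) (fun i => θ i ω) n) = fun ω =>
      (ρ + maxAge (fun i => v i ω) (n + 1)) * dist (θ n ω) (θ (n + 1) ω) ^ 2 +
        ∑ i ∈ Finset.range (n + 1), if n - maxAge (fun i => v i ω) (n + 1) ≤ i then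
          dist (θ i ω) (θ (i + 1) ω) ^ 2 else 0 := by
    ext ω
    rw [windowEnergy, dynamicReg_eq, ← Finset.sum_filter]
    congr 2
    ext i
    simp only [Finset.mem_Ico, Finset.mem_filter, Finset.mem_range]
    exact and_comm
  rw [this]
  refine ((hmR.const_add ρ).mul (hdist n)).add (Finset.measurable_sum _ fun i _ => ?_)
  refine Measurable.ite (measurableSet_le ?_ measurable_const) (hdist i) measurable_const
  exact (measurable_from_top (f := fun k : ℕ => n - k)).comp hm

namespace IsDynamicProxRun

/-- Only one factor of the age is lost: Cauchy–Schwarz over the `m + 1` steps of the window costs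
one, and in the proximal term one factor `ρ + m` stays in the energy while the other is at most `(1
+ ρ) (m + 1)`. -/
lemma optGap_sq_le (h : IsDynamicProxRun Θ π f L μ ρ θ₀ v θ g) (hΘ : Convex ℝ Θ)
    (hπ : ∀ u, 0 ≤ π u) (hπ1 : ∑ u, π u = 1) (hρ : 0 ≤ ρ)
    (hdir : ∀ x ∈ Θ, ∀ y ∈ Θ, HasDirDeriv (weighted π f) x (y - x))
    (hnonneg : ∀ x ∈ Θ, 0 ≤ optGap Θ (weighted π f) x) (n : ℕ) :
    optGap Θ (weighted π f) (θ (n + 1)) ^ 2 ≤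
      (2 * (1 + ρ) + 2 * (L : ℝ) ^ 2) *
        (((maxAge v (n + 1) : ℝ) + 1) * windowEnergy ρ v θ n) := by
  set m := maxAge v (n + 1) with hm
  set I := Finset.Ico (n - m) (n + 1)
  set D : ℕ → ℝ := fun i => dist (θ i) (θ (i + 1))
  set O := optGap Θ (weighted π f) (θ (n + 1))
  set S := ∑ i ∈ I, D i
  set Y := ∑ i ∈ I, D i ^ 2
  have hO : 0 ≤ O := hnonneg _ (h.mem n)
  have hS0 : 0 ≤ S := Finset.sum_nonneg fun i _ => dist_nonneg
  have hY0 : 0 ≤ Y := Finset.sum_nonneg fun i _ => sq_nonneg _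
  have hD0 : 0 ≤ D n := dist_nonneg
  have hm0 : (0 : ℝ) ≤ m := Nat.cast_nonneg m
  have hgrad : ‖gradient (weighted π (g (n + 1)) - weighted π f) (θ (n + 1))‖ ≤ L * S := by
    refine (norm_gradient_weighted_sub_le hπ
      (fun u => (h.mem_strongSurrogates (n + 1) u).1) _).trans ?_
    refine mul_le_mul_of_nonneg_left ?_ L.2
    calc ∑ u, π u * dist (θ (n + 1)) (θ (lastPassage v (n + 1) u - 1))
        ≤ ∑ u, π u * S := Finset.sum_le_sum fun u _ =>
          mul_le_mul_of_nonneg_left (dist_lastPassage_le θ n u) (hπ u)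
      _ = S := by rw [← Finset.sum_mul, hπ1, one_mul]
  have hOle : O ≤ (ρ + m) * D n + L * S :=
    (h.optGap_le_gradient hΘ hρ hdir n).trans (by rw [dynamicReg_eq]; gcongr)
  have hcard : (I.card : ℝ) = m + 1 := by
    have : m ≤ n := maxAge_succ_le
    rw [Nat.card_Ico]
    have : n + 1 - (n - m) = m + 1 := by omega
    rw [this]
    push_cast
    rfl
  have hSY : S ^ 2 ≤ (m + 1) * Y := by
    rw [← hcard]
    exact sq_sum_le_card_mul_sum_sq
  have hR0 : 0 ≤ ρ + m := by positivity
  have hRle : ρ + m ≤ (1 + ρ) * (m + 1) := by nlinarith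
  have hX0 : 0 ≤ (ρ + m) * D n ^ 2 := by positivity
  calc O ^ 2 ≤ ((ρ + m) * D n + L * S) ^ 2 := by gcongr
    _ ≤ 2 * (((ρ + m) * D n) ^ 2 + (L * S) ^ 2) := add_sq_le
    _ = 2 * (ρ + m) * ((ρ + m) * D n ^ 2) + 2 * (L : ℝ) ^ 2 * S ^ 2 := by ring
    _ ≤ 2 * ((1 + ρ) * (m + 1)) * ((ρ + m) * D n ^ 2) +
        2 * (L : ℝ) ^ 2 * ((m + 1) * Y) := by gcongr
    _ ≤ 2 * ((1 + ρ) * (m + 1)) * ((ρ + m) * D n ^ 2 + Y) +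
        2 * (L : ℝ) ^ 2 * ((m + 1) * ((ρ + m) * D n ^ 2 + Y)) := by
      gcongr <;> linarith
    _ = (2 * (1 + ρ) + 2 * (L : ℝ) ^ 2) * ((m + 1) * ((ρ + m) * D n ^ 2 + Y)) := by ring

lemma sum_dist_sq_le (h : IsDynamicProxRun Θ π f L μ ρ θ₀ v θ g) (hΘ : Convex ℝ Θ)
    (hπ : ∀ u, 0 ≤ π u) (hπ1 : ∑ u, π u = 1) (hρ : 0 ≤ ρ) (hρμ : 0 < ρ + μ) {B : ℝ}
    (hB : ∀ x ∈ Θ, B ≤ weighted π f x) (N : ℕ) :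
    ∑ n ∈ Finset.range N, dist (θ n) (θ (n + 1)) ^ 2 ≤
      4 * (weighted π f θ₀ - B) / (ρ + μ) := by
  rw [le_div_iff₀ hρμ, Finset.sum_mul]
  refine le_trans (Finset.sum_le_sum fun n _ => ?_) (h.sum_le hΘ hπ hπ1 hρ hB N)
  rw [mul_comm, dynamicReg_eq]
  refine mul_le_mul_of_nonneg_right ?_ (sq_nonneg _)
  linarith [Nat.cast_nonneg (α := ℝ) (maxAge v (n + 1))]

lemma sum_reg_mul_dist_sq_le (h : IsDynamicProxRun Θ π f L μ ρ θ₀ v θ g) (hΘ : Convex ℝ Θ)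
    (hπ : ∀ u, 0 ≤ π u) (hπ1 : ∑ u, π u = 1) (hμ : 0 ≤ μ) (hρ : 0 ≤ ρ) {B : ℝ}
    (hB : ∀ x ∈ Θ, B ≤ weighted π f x) (N : ℕ) :
    ∑ n ∈ Finset.range N, dynamicReg ρ v (n + 1) * dist (θ n) (θ (n + 1)) ^ 2 ≤
      4 * (weighted π f θ₀ - B) := by
  refine le_trans (Finset.sum_le_sum fun n _ => ?_) (h.sum_le hΘ hπ hπ1 hρ hB N)
  exact mul_le_mul_of_nonneg_right (by linarith) (sq_nonneg _)

lemma windowEnergy_le (h : IsDynamicProxRun Θ π f L μ ρ θ₀ v θ g) (hΘ : Convex ℝ Θ)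
    (hπ : ∀ u, 0 ≤ π u) (hπ1 : ∑ u, π u = 1) (hμ : 0 ≤ μ) (hρ : 0 ≤ ρ) (hρμ : 0 < ρ + μ) {B : ℝ}
    (hB : ∀ x ∈ Θ, B ≤ weighted π f x) (n : ℕ) :
    windowEnergy ρ v θ n ≤
      4 * (weighted π f θ₀ - B) + 4 * (weighted π f θ₀ - B) / (ρ + μ) := by
  refine add_le_add (le_trans ?_ (h.sum_reg_mul_dist_sq_le hΘ hπ hπ1 hμ hρ hB (n + 1)))
    (le_trans ?_ (h.sum_dist_sq_le hΘ hπ hπ1 hρ hρμ hB (n + 1)))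
  · exact Finset.single_le_sum (f := fun n => dynamicReg ρ v (n + 1) *
      dist (θ n) (θ (n + 1)) ^ 2)
      (fun i _ => by rw [dynamicReg_eq]; positivity) (Finset.self_mem_range_succ n)
  · refine Finset.sum_le_sum_of_subset_of_nonneg ?_ fun _ _ _ => sq_nonneg _
    intro i hi
    exact Finset.mem_range.2 (Finset.mem_Ico.1 hi).2

lemma tendsto_windowEnergy [Nonempty V] (h : IsDynamicProxRun Θ π f L μ ρ θ₀ v θ g)
    (hΘ : Convex ℝ Θ) (hπ : ∀ u, 0 ≤ π u) (hπ1 : ∑ u, π u = 1) (hμ : 0 ≤ μ) (hρ : 0 ≤ ρ)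
    (hρμ : 0 < ρ + μ) {B : ℝ} (hB : ∀ x ∈ Θ, B ≤ weighted π f x)
    (hrec : ∀ u N, ∃ j, N ≤ j ∧ v j = u) :
    Tendsto (windowEnergy ρ v θ) atTop (𝓝 0) := by
  have h1 := (summable_of_sum_range_le (fun n => by rw [dynamicReg_eq]; positivity)
    (h.sum_reg_mul_dist_sq_le hΘ hπ hπ1 hμ hρ hB)).tendsto_atTop_zero
  have h2 := (summable_of_sum_range_le (fun n => sq_nonneg _)
    (h.sum_dist_sq_le hΘ hπ hπ1 hρ hρμ hB)).hasSum.tendsto_sum_nat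
  have hstart : Tendsto (fun n => n - maxAge v (n + 1)) atTop atTop := by
    have := (tendsto_sub_atTop_nat 1).comp
      ((tendsto_sub_maxAge hrec).comp (tendsto_add_atTop_nat 1))
    refine this.congr fun n => ?_
    simp only [Function.comp]
    omega
  -- Both ends of the window go to infinity, so the window sum is a difference of partial sums with
  -- the same limit.
  have h3 := (h2.comp (tendsto_add_atTop_nat 1)).sub (h2.comp hstart)
  rw [sub_self] at h3
  rw [← add_zero (0 : ℝ)]
  refine h1.add (h3.congr fun n => ?_)
  exact (Finset.sum_Ico_eq_sub _ ((Nat.sub_le _ _).trans (Nat.le_succ n))).symm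

end IsDynamicProxRun

end DynamicProx

/-! ### Dynamic proximal regularization: convergence in mean square -/

section DynamicProxLimit

variable {p : ℕ} {V Ω : Type*} [Fintype V] [MeasurableSpace V] [MeasurableSingletonClass V]
  [MeasurableSpace Ω] {P : Measure Ω} [IsProbabilityMeasure P] {Θ : Set (Param p)} {π : V → ℝ}
  {f : V → Param p → ℝ} {L : ℝ≥0} {μ ρ : ℝ} {θ₀ : Param p} {v : ℕ → Ω → V}
  {θ : ℕ → Ω → Param p} {g : ℕ → Ω → V → Param p → ℝ}

omit [MeasurableSpace V] [MeasurableSingletonClass V] in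
lemma exists_surrogate_of_dynamicProx (hπ : ∀ u, 0 ≤ π u) (hπ1 : ∑ u, π u = 1)
    (hrun : ∀ᵐ ω ∂P, IsDynamicProxRun Θ π f L μ ρ θ₀ (fun n => v n ω) (fun n => θ n ω)
      (fun n => g n ω)) :
    ∃ G, G ∈ surrogates Θ L (weighted π f) θ₀ := by
  obtain ⟨ω, hω⟩ := hrun.exists
  exact ⟨_, weighted_mem_surrogates hπ hπ1 fun u => (hω.init_surrogate u).1⟩

/-- Convergence in mean square of the optimality gap under dynamic proximal regularization. -/
theorem dynamicProx_optGap_tendsto (hΘ : Convex ℝ Θ) (hπ : ∀ u, 0 ≤ π u) (hπ1 : ∑ u, π u = 1)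
    (hf : RegularOn Θ f) (hv : ∀ n, Measurable (v n)) (hθ : ∀ n, Measurable (θ n))
    (hrec : IsRecurrent P v θ) (hμ : 0 ≤ μ) (hρ : 0 ≤ ρ) (hρμ : 0 < ρ + μ)
    (hrun : ∀ᵐ ω ∂P, IsDynamicProxRun Θ π f L μ ρ θ₀ (fun n => v n ω) (fun n => θ n ω)
      (fun n => g n ω)) :
    (∀ x ∈ Θ, BddAbove (descentRates Θ (weighted π f) x)) ∧
    (∀ n, Integrable (fun ω => optGap Θ (weighted π f) (θ n ω)) P) ∧
    (∀ n, Integrable (fun ω => optGap Θ (weighted π f) (θ n ω) ^ 2) P) ∧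
    Tendsto (fun n => ∫ ω, optGap Θ (weighted π f) (θ n ω) ∂P) atTop (𝓝 0) ∧
    Tendsto (fun n => ∫ ω, optGap Θ (weighted π f) (θ n ω) ^ 2 ∂P) atTop (𝓝 0) := by
  have hV : Nonempty V := by
    by_contra hne
    rw [not_nonempty_iff] at hne
    simp at hπ1
  -- The initial surrogates may depend on `ω`; those of one good outcome suffice to derive the
  -- regularity of the objective.
  obtain ⟨G, hG⟩ := exists_surrogate_of_dynamicProx hπ hπ1 hrun
  obtain ⟨B, hB⟩ := hf.exists_lowerBound hπ
  have hdir := hf.hasDirDeriv_weighted (π := π)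
  set F := weighted π f with hF
  have hbdd : ∀ x ∈ Θ, BddAbove (descentRates Θ F x) := fun x hx =>
    bddAbove_descentRates hG (hdir x hx)
  have hnonneg : ∀ x ∈ Θ, 0 ≤ optGap Θ F x := fun x hx => optGap_nonneg hG hx (hdir x hx)
  have hmeas : ∀ n, AEMeasurable (fun ω => optGap Θ F (θ n ω)) P := fun n =>
    aemeasurable_optGap_comp hΘ hG hdir (hθ n) (hrun.mono fun ω h => h.mem_feasible n)
  set C := 4 * (F θ₀ - B) + 4 * (F θ₀ - B) / (ρ + μ) with hC
  set K := 2 * (1 + ρ) + 2 * (L : ℝ) ^ 2 with hK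
  have hK0 : 0 ≤ K := by positivity
  let m : ℕ → Ω → ℕ := fun n ω => maxAge (fun i => v i ω) (n + 1)
  let Z : ℕ → Ω → ℝ := fun n ω => windowEnergy ρ (fun i => v i ω) (fun i => θ i ω) n
  have hZC : ∀ n, ∀ᵐ ω ∂P, Z n ω ≤ C := fun n => hrun.mono fun ω h =>
    h.windowEnergy_le hΘ hπ hπ1 hμ hρ hρμ hB n
  have hZ0 : ∀ n ω, 0 ≤ Z n ω := fun n ω => windowEnergy_nonneg hρ n
  have hmn : ∀ n ω, m n ω ≤ n := fun n ω => maxAge_succ_le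
  have hsq : ∀ n, ∀ᵐ ω ∂P,
      optGap Θ F (θ (n + 1) ω) ^ 2 ≤ K * (((m n ω : ℝ) + 1) * Z n ω) := fun n =>
    hrun.mono fun ω h => h.optGap_sq_le hΘ hπ hπ1 hρ hdir hnonneg n
  have hmZ : ∀ n, ∀ᵐ ω ∂P, ((m n ω : ℝ) + 1) * Z n ω ≤ ((n : ℝ) + 1) * C := fun n => by
    filter_upwards [hZC n] with ω hω
    have h1 : (m n ω : ℝ) ≤ n := Nat.cast_le.2 (hmn n ω)
    have := hZ0 n ω
    gcongr
  -- For fixed `n` the crude bound `m ≤ n` on the age already makes the gap essentially bounded,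
  -- hence integrable.
  have hbound : ∀ n, ∃ c : ℝ, ∀ᵐ ω ∂P, optGap Θ F (θ n ω) ^ 2 ≤ c := by
    intro n
    cases n with
    | zero => exact ⟨optGap Θ F θ₀ ^ 2, hrun.mono fun ω h => by rw [h.init]⟩
    | succ n =>
      refine ⟨K * (((n : ℝ) + 1) * C), ?_⟩
      filter_upwards [hsq n, hmZ n] with ω h1 h2
      exact h1.trans (mul_le_mul_of_nonneg_left h2 hK0)
  have hint2 : ∀ n, Integrable (fun ω => optGap Θ F (θ n ω) ^ 2) P := fun n => by
    obtain ⟨c, hc⟩ := hbound n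
    refine Integrable.of_bound ((hmeas n).pow_const 2).aestronglyMeasurable c ?_
    filter_upwards [hc] with ω hω
    rwa [Real.norm_of_nonneg (sq_nonneg _)]
  have hLp : ∀ n, MemLp (fun ω => optGap Θ F (θ n ω)) 2 P := fun n =>
    (memLp_two_iff_integrable_sq (hmeas n).aestronglyMeasurable).2 (hint2 n)
  have hint : ∀ n, Integrable (fun ω => optGap Θ F (θ n ω)) P := fun n =>
    (hLp n).integrable (by norm_num)
  have hlim2 : Tendsto (fun n => ∫ ω, optGap Θ F (θ n ω) ^ 2 ∂P) atTop (𝓝 0) := by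
    obtain ⟨q, hq, hqm⟩ := hrec.exists_summable_tail hv hθ
    have hZm : ∀ n, Measurable (Z n) := measurable_windowEnergy hv hθ
    have hmm : ∀ n, Measurable (m n) := fun n => measurable_maxAge hv (n + 1)
    have hlimit := (tendsto_integral_mul_of_summable_tail (Z := Z) (C := C) hmm hmn hZm
      (fun n => by
        filter_upwards [hZC n] with ω hω
        rwa [Real.norm_of_nonneg (hZ0 n ω)])
      (by
        filter_upwards [hrun, hrec.ae_frequently hv hθ] with ω h1 h2
        exact h1.tendsto_windowEnergy hΘ hπ hπ1 hμ hρ hρμ hB h2) hq hqm).const_mul K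
    rw [mul_zero] at hlimit
    rw [← tendsto_add_atTop_iff_nat 1]
    refine squeeze_zero (fun n => integral_nonneg fun ω => sq_nonneg _) (fun n => ?_) hlimit
    rw [← integral_const_mul]
    refine integral_mono_ae (hint2 _) (Integrable.const_mul ?_ K) (hsq n)
    have hmR : Measurable fun ω => (m n ω : ℝ) :=
      (measurable_from_top (f := fun k : ℕ => (k : ℝ))).comp (hmm n)
    refine Integrable.of_bound ((hmR.add_const 1).mul (hZm n)).aestronglyMeasurable
      (((n : ℝ) + 1) * C) ?_
    filter_upwards [hmZ n] with ω hω
    rwa [Real.norm_of_nonneg (mul_nonneg (by positivity) (hZ0 n ω))]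
  refine ⟨hbdd, hint, hint2, ?_, hlim2⟩
  have hsqrt := (Real.continuous_sqrt.tendsto 0).comp hlim2
  rw [Real.sqrt_zero] at hsqrt
  refine squeeze_zero_norm (fun n => ?_) hsqrt
  refine Real.abs_le_sqrt ?_
  -- Nonnegative variance bounds the squared mean by the second moment.
  have h1 := ProbabilityTheory.variance_nonneg (fun ω => optGap Θ F (θ n ω)) P
  rw [ProbabilityTheory.variance_eq_sub (hLp n)] at h1
  exact sub_nonneg.1 h1

end DynamicProxLimit

/-! ### Trapping near a limit point -/

section Trapping

/-- Within `η` of `x`, each unit of path length uses up at least `ε` of the convergent sum. Starting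
within `η / 2` of `x`, with less than `ε η / 2` of the sum left, the sequence cannot travel `η / 2`;
it is trapped, so the radii would have bounded sum. -/
lemma false_of_mapClusterPt_of_summable {E : Type*} [PseudoMetricSpace E] {θ : ℕ → E}
    {r O : ℕ → ℝ} (hdist : ∀ n, dist (θ n) (θ (n + 1)) ≤ r n)
    (hr : Tendsto (fun N => ∑ n ∈ Finset.range N, r n) atTop atTop) (hO : ∀ n, 0 ≤ O n)
    (hsum : Summable fun n => r n * O n) {x : E} (hx : MapClusterPt x atTop θ) {ε η : ℝ}
    (hε : 0 < ε) (hη : 0 < η) (hlow : ∀ n, dist (θ n) x < η → ε ≤ O n) : False := by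
  have hr0 : ∀ n, 0 ≤ r n := fun n => dist_nonneg.trans (hdist n)
  have ha0 : ∀ n, 0 ≤ r n * O n := fun n => mul_nonneg (hr0 n) (hO n)
  obtain ⟨N, hN⟩ : ∃ N, ∑' n, r n * O n - ε * (η / 2) < ∑ n ∈ Finset.range N, r n * O n :=
    (hsum.hasSum.tendsto_sum_nat.eventually_const_lt
      (sub_lt_self _ (by positivity))).exists
  obtain ⟨n₀, hn₀, hxn₀⟩ : ∃ n ≥ N, dist (θ n) x < η / 2 :=
    frequently_atTop.1 (hx.frequently (Metric.ball_mem_nhds x (half_pos hη))) N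
  have htail : ∀ n, n₀ ≤ n → ∑ i ∈ Finset.Ico n₀ n, r i * O i < ε * (η / 2) := by
    intro n hn
    have h1 : ∑ i ∈ Finset.range n, r i * O i ≤ ∑' n, r n * O n :=
      hsum.sum_le_tsum _ fun i _ => ha0 i
    have h2 : ∑ i ∈ Finset.range N, r i * O i ≤ ∑ i ∈ Finset.range n₀, r i * O i :=
      Finset.sum_le_sum_of_subset_of_nonneg (Finset.range_mono hn₀) fun i _ _ => ha0 i
    rw [Finset.sum_Ico_eq_sub _ hn]
    linarith
  have key : ∀ n, n₀ ≤ n →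
      ε * ∑ i ∈ Finset.Ico n₀ n, r i ≤ ∑ i ∈ Finset.Ico n₀ n, r i * O i := by
    intro n hn
    induction n, hn using Nat.le_induction with
    | base => simp
    | succ n hn ih =>
      have h1 : ∑ i ∈ Finset.Ico n₀ n, r i < η / 2 :=
        lt_of_mul_lt_mul_left (ih.trans_lt (htail n hn)) hε.le
      have h2 : dist (θ n₀) (θ n) ≤ ∑ i ∈ Finset.Ico n₀ n, r i :=
        (dist_le_Ico_sum_dist θ hn).trans (Finset.sum_le_sum fun i _ => hdist i)
      have h3 : dist (θ n) x < η := by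
        have := dist_triangle_left (θ n) x (θ n₀)
        linarith
      rw [Finset.sum_Ico_succ_top hn, Finset.sum_Ico_succ_top hn, mul_add]
      have := mul_le_mul_of_nonneg_left (hlow n h3) (hr0 n)
      linarith
  obtain ⟨n, hn, hn'⟩ := ((hr.eventually_ge_atTop
    (∑ i ∈ Finset.range n₀, r i + η / 2)).and (eventually_ge_atTop n₀)).exists
  have h1 : ∑ i ∈ Finset.Ico n₀ n, r i < η / 2 :=
    lt_of_mul_lt_mul_left ((key n hn').trans_lt (htail n hn')) hε.le
  rw [Finset.sum_Ico_eq_sub _ hn'] at h1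
  linarith

end Trapping

/-! ### Radii and drift since the last passage -/

section Radii

variable {r : ℕ → ℝ}

lemma IsRadiusSequence.antitone_succ (hr : IsRadiusSequence r) : Antitone fun n => r (n + 1) :=
  antitone_nat_of_succ_le fun n => hr.antitone (n + 1) (by omega)

lemma IsRadiusSequence.tendsto_sum (hr : IsRadiusSequence r) :
    Tendsto (fun N => ∑ n ∈ Finset.range N, r (n + 1)) atTop atTop := by
  refine hr.sum_atTop.congr fun N => ?_
  induction N with
  | zero => simp
  | succ N ih => rw [Finset.sum_Icc_succ_top (by omega), ih, Finset.sum_range_succ]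

lemma IsRadiusSequence.summable_succ_sq (hr : IsRadiusSequence r) :
    Summable fun n => r (n + 1) ^ 2 :=
  (summable_nat_add_iff 1).2 hr.sq_summable

/-- The drift of the iterates since the last passage, weighted by the radii, is controlled by the
return times. -/
lemma sum_mul_sum_lastPassage_le {V : Type*} {v : ℕ → V} {u : V}
    (hr0 : ∀ n, 0 ≤ r (n + 1)) (hr : Antitone fun n => r (n + 1))
    (htop : ∀ n, 1 ≤ n → returnTime v n u ≠ ⊤) (N : ℕ) :
    ∑ n ∈ Finset.range N, r (n + 1) *
        ∑ i ∈ Finset.Ico (lastPassage v (n + 1) u - 1) n, r (i + 1) ≤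
      ∑ i ∈ Finset.range N, r (i + 1) ^ 2 * ((returnTime v (i + 1) u).toNat : ℝ) := by
  calc ∑ n ∈ Finset.range N, r (n + 1) *
        ∑ i ∈ Finset.Ico (lastPassage v (n + 1) u - 1) n, r (i + 1)
      ≤ ∑ n ∈ Finset.range N, ∑ i ∈ Finset.range N,
          if lastPassage v (n + 1) u - 1 ≤ i ∧ i < n then r (i + 1) ^ 2 else 0 := by
        -- For `i < n` monotonicity replaces `r (n + 1) * r (i + 1)` by `r (i + 1) ^ 2`, which no
        -- longer depends on `n`; the sums can then be exchanged.
        refine Finset.sum_le_sum fun n hn => ?_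
        have hn' := Finset.mem_range.1 hn
        have hfil : (Finset.range N).filter
            (fun i => lastPassage v (n + 1) u - 1 ≤ i ∧ i < n) =
            Finset.Ico (lastPassage v (n + 1) u - 1) n := by
          ext i
          simp only [Finset.mem_filter, Finset.mem_range, Finset.mem_Ico]
          omega
        rw [← Finset.sum_filter, hfil, Finset.mul_sum]
        refine Finset.sum_le_sum fun i hi => ?_
        rw [sq]
        exact mul_le_mul_of_nonneg_right (hr (Finset.mem_Ico.1 hi).2.le) (hr0 i)
    _ = ∑ i ∈ Finset.range N, ∑ n ∈ Finset.range N,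
          if lastPassage v (n + 1) u - 1 ≤ i ∧ i < n then r (i + 1) ^ 2 else 0 :=
        Finset.sum_comm
    _ ≤ _ := by
        refine Finset.sum_le_sum fun i _ => ?_
        rw [← Finset.sum_filter, Finset.sum_const, nsmul_eq_mul, mul_comm]
        refine mul_le_mul_of_nonneg_left ?_ (sq_nonneg _)
        rw [Nat.cast_le]
        -- Such an `n` means `u` is absent at times `i + 2, …, n + 1`, so the return time from `i +
        -- 1` is at least `n - i + 1`.
        refine (Finset.card_le_card (t := Finset.Ico i (i + (returnTime v (i + 1) u).toNat))
          fun n hn => ?_).trans (by simp)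
        obtain ⟨-, h1, h2⟩ := Finset.mem_filter.1 hn
        rw [Finset.mem_Ico]
        refine ⟨h2.le, ?_⟩
        have hret : ((n - i + 1 : ℕ) : ℕ∞) ≤ returnTime v (i + 1) u :=
          succ_le_returnTime fun j hj1 hj2 =>
            ne_of_lastPassage_lt (n := n + 1) (by omega) (by omega)
        have := ENat.toNat_le_toNat hret (htop (i + 1) (by omega))
        rw [ENat.toNat_natCast] at this
        omega

end Radii

/-! ### Diminishing radius: stationarity of limit points -/

section DiminishingRadius

variable {p : ℕ} {V : Type*} [Fintype V] {Θ : Set (Param p)} {π : V → ℝ}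
  {f : V → Param p → ℝ} {L : ℝ≥0} {r : ℕ → ℝ} {θ₀ : Param p}
  {v : ℕ → V} {θ : ℕ → Param p} {g : ℕ → V → Param p → ℝ}

omit [Fintype V] in
lemma Smooth.differentiable (hs : Smooth L f) (u : V) : Differentiable ℝ (f u) :=
  (hs u).1.differentiable one_ne_zero

namespace IsDiminishingRadiusRun

lemma mem_feasible (h : IsDiminishingRadiusRun Θ π f L r θ₀ v θ g) (n : ℕ) : θ n ∈ Θ := by
  cases n with
  | zero => rw [h.init]; exact h.init_mem
  | succ n => exact (h.mem n).1

lemma dist_le (h : IsDiminishingRadiusRun Θ π f L r θ₀ v θ g) (n : ℕ) :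
    dist (θ n) (θ (n + 1)) ≤ r (n + 1) := by
  rw [dist_comm]
  exact (h.mem n).2

lemma radius_nonneg (h : IsDiminishingRadiusRun Θ π f L r θ₀ v θ g) (n : ℕ) : 0 ≤ r (n + 1) :=
  dist_nonneg.trans (h.dist_le n)

lemma mem_surrogates (h : IsDiminishingRadiusRun Θ π f L r θ₀ v θ g) (n : ℕ) (u : V) :
    g n u ∈ surrogates Θ L (f u) (θ (lastPassage v n u - 1)) := by
  induction n with
  | zero =>
    rw [lastPassage_zero, Nat.sub_self, h.init]
    exact h.init_surrogate u
  | succ n ih =>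
    by_cases hu : v (n + 1) = u
    · rw [lastPassage_succ_of_eq hu, Nat.add_sub_cancel, ← hu]
      exact h.update n
    · rw [lastPassage_succ_of_ne hu, h.keep n u (Ne.symm hu)]
      exact ih

lemma update_le (h : IsDiminishingRadiusRun Θ π f L r θ₀ v θ g) (hπ : ∀ u, 0 ≤ π u) (n : ℕ) :
    weighted π (g (n + 1)) (θ n) ≤ weighted π (g n) (θ n) :=
  weighted_update_le hπ (h.mem_feasible n) (h.mem_surrogates n) (h.update n) (h.keep n)

lemma value_antitone (h : IsDiminishingRadiusRun Θ π f L r θ₀ v θ g) (hπ : ∀ u, 0 ≤ π u)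
    (n : ℕ) : weighted π (g (n + 1)) (θ (n + 1)) ≤ weighted π (g n) (θ n) :=
  (h.argmin n ⟨h.mem_feasible n, Metric.mem_closedBall_self (h.radius_nonneg n)⟩).trans
    (h.update_le hπ n)

lemma norm_gradient_le (h : IsDiminishingRadiusRun Θ π f L r θ₀ v θ g) (hπ : ∀ u, 0 ≤ π u)
    (n : ℕ) : ‖gradient (weighted π (g (n + 1)) - weighted π f) (θ n)‖ ≤
      L * ∑ u, π u * ∑ i ∈ Finset.Ico (lastPassage v (n + 1) u - 1) n, r (i + 1) := by
  refine (norm_gradient_weighted_sub_le hπ (h.mem_surrogates (n + 1)) _).trans ?_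
  refine mul_le_mul_of_nonneg_left (Finset.sum_le_sum fun u _ =>
    mul_le_mul_of_nonneg_left ?_ (hπ u)) L.2
  have := lastPassage_succ_le (v := v) (n := n) (u := u)
  rw [dist_comm]
  exact (dist_le_Ico_sum_dist θ (by omega)).trans (Finset.sum_le_sum fun i _ => h.dist_le i)

/-- The competitor is `θ n + t • d` with `t = r (n + 1)`, feasible by convexity as `t ≤ 1`. Taylor's
estimate is used for the objective and for the error, each costing `L t²`. -/
lemma radius_mul_optGap_le (h : IsDiminishingRadiusRun Θ π f L r θ₀ v θ g) (hΘ : Convex ℝ Θ)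
    (hπ : ∀ u, 0 ≤ π u) (hπ1 : ∑ u, π u = 1) (hs : Smooth L f) {n : ℕ} (hr1 : r (n + 1) ≤ 1) :
    r (n + 1) * optGap Θ (weighted π f) (θ n) ≤
      (weighted π (g n) (θ n) - weighted π (g (n + 1)) (θ (n + 1))) +
      r (n + 1) * ‖gradient (weighted π (g (n + 1)) - weighted π f) (θ n)‖ +
      2 * L * r (n + 1) ^ 2 := by
  set t := r (n + 1) with ht
  have ht0 : 0 ≤ t := h.radius_nonneg n
  set F := weighted π f with hF
  set G := weighted π (g (n + 1)) with hG
  have hFd : Differentiable ℝ F := differentiable_weighted hs.differentiable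
  have hFL : LipschitzWith L (gradient F) :=
    lipschitzWith_gradient_weighted hπ hπ1 hs.differentiable fun u => (hs u).2
  have hHd : Differentiable ℝ (G - F) := by
    rw [hG, weighted_sub]
    exact differentiable_weighted fun u => (h.mem_surrogates (n + 1) u).2.2.1
  have hHL : LipschitzWith L (gradient (G - F)) := by
    rw [hG, weighted_sub]
    exact lipschitzWith_gradient_weighted hπ hπ1 (fun u => (h.mem_surrogates (n + 1) u).2.2.1)
      fun u => (h.mem_surrogates (n + 1) u).2.2.2.1
  set C := (weighted π (g n) (θ n) - G (θ (n + 1))) + t * ‖gradient (G - F) (θ n)‖ +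
    2 * L * t ^ 2 with hC
  have hC0 : 0 ≤ C := by
    have := h.value_antitone hπ n
    have : 0 ≤ weighted π (g n) (θ n) - G (θ (n + 1)) := sub_nonneg.2 this
    positivity
  rcases ht0.eq_or_lt with ht00 | htpos
  · rwa [← ht00, zero_mul]
  rw [mul_comm, ← le_div_iff₀ htpos]
  refine optGap_le (h.mem_feasible n) fun y hy hyx => ?_
  rw [le_div_iff₀ htpos, dirDeriv_eq_inner hFd]
  set x := θ n
  set d := y - x with hd
  have hnorm : ‖t • d‖ ≤ t := by
    rw [norm_smul, Real.norm_of_nonneg ht0]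
    exact mul_le_of_le_one_right ht0 hyx
  have hmem : x + t • d ∈ Θ := hΘ.add_smul_sub_mem (h.mem_feasible n) hy ⟨ht0, hr1⟩
  have hmin : G (θ (n + 1)) ≤ G (x + t • d) :=
    h.argmin n ⟨hmem, by rw [mem_closedBall_iff_norm, add_sub_cancel_left]; exact hnorm⟩
  have h1 := (abs_le.1 (abs_sub_sub_inner_le hFd hFL x (t • d))).2
  have h2 := (abs_le.1 (abs_sub_sub_inner_le hHd hHL x (t • d))).2
  have h3 : (L : ℝ) * ‖t • d‖ ^ 2 ≤ L * t ^ 2 := by gcongr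
  have h4 : inner ℝ (gradient (G - F) x) (t • d) ≤ t * ‖gradient (G - F) x‖ := by
    rw [mul_comm]
    exact (real_inner_le_norm _ _).trans (mul_le_mul_of_nonneg_left hnorm (norm_nonneg _))
  have h5 := h.update_le hπ n
  rw [inner_smul_right] at h1
  simp only [Pi.sub_apply] at h2
  linarith

lemma summable_radius_mul_optGap (h : IsDiminishingRadiusRun Θ π f L r θ₀ v θ g)
    (hΘ : Convex ℝ Θ) (hπ : ∀ u, 0 ≤ π u) (hπ1 : ∑ u, π u = 1) (hs : Smooth L f)
    (hr : IsRadiusSequence r) {B : ℝ} (hB : ∀ x ∈ Θ, B ≤ weighted π f x)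
    (hnonneg : ∀ x ∈ Θ, 0 ≤ optGap Θ (weighted π f) x)
    (htop : ∀ u n, 1 ≤ n → returnTime v n u ≠ ⊤)
    (hret : ∀ u, Summable fun n => r (n + 1) ^ 2 * ((returnTime v (n + 1) u).toNat : ℝ)) :
    Summable fun n => r (n + 1) * optGap Θ (weighted π f) (θ n) := by
  have hdecr : Summable fun n => weighted π (g n) (θ n) - weighted π (g (n + 1)) (θ (n + 1)) := by
    refine summable_of_sum_range_le (c := weighted π (g 0) (θ 0) - B)
      (fun n => sub_nonneg.2 (h.value_antitone hπ n)) fun N => ?_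
    rw [Finset.sum_range_sub' (fun n => weighted π (g n) (θ n))]
    have := (hB _ (h.mem_feasible N)).trans
      (weighted_le hπ fun u => (h.mem_surrogates N u).2.1 _ (h.mem_feasible N))
    linarith
  have hdrift : ∀ u, Summable fun n => r (n + 1) *
      ∑ i ∈ Finset.Ico (lastPassage v (n + 1) u - 1) n, r (i + 1) := by
    intro u
    refine summable_of_sum_range_le (fun n => mul_nonneg (h.radius_nonneg n)
      (Finset.sum_nonneg fun i _ => h.radius_nonneg i)) fun N =>
      (sum_mul_sum_lastPassage_le h.radius_nonneg hr.antitone_succ (htop u) N).trans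
        ((hret u).sum_le_tsum _ fun i _ => by positivity)
  have hdrift' := (summable_sum (s := Finset.univ)
    fun u _ => (hdrift u).mul_left (π u)).mul_left (L : ℝ)
  have hr1 : ∀ᶠ n in atTop, r (n + 1) ≤ 1 := by
    filter_upwards [hr.summable_succ_sq.tendsto_atTop_zero.eventually_le_const one_pos] with n hn
    nlinarith [h.radius_nonneg n]
  refine Summable.of_norm_bounded_eventually_nat
    ((hdecr.add hdrift').add (hr.summable_succ_sq.mul_left (2 * (L : ℝ)))) ?_
  filter_upwards [hr1] with n hn
  rw [Real.norm_of_nonneg (mul_nonneg (h.radius_nonneg n) (hnonneg _ (h.mem_feasible n)))]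
  refine (h.radius_mul_optGap_le hΘ hπ hπ1 hs hn).trans ?_
  have := mul_le_mul_of_nonneg_left (h.norm_gradient_le hπ n) (h.radius_nonneg n)
  have heq : r (n + 1) * (L * ∑ u, π u *
      ∑ i ∈ Finset.Ico (lastPassage v (n + 1) u - 1) n, r (i + 1)) =
      L * ∑ u, π u * (r (n + 1) *
        ∑ i ∈ Finset.Ico (lastPassage v (n + 1) u - 1) n, r (i + 1)) := by
    rw [mul_left_comm, Finset.mul_sum]
    congr 1
    exact Finset.sum_congr rfl fun u _ => by ring
  rw [heq] at this
  linarith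

end IsDiminishingRadiusRun

/-- Since `x` may lie outside `Θ`, the rate 0 need not be attained; feasible points close to `x`
have rates close to 0, so the supremum is still at least 0. -/
lemma isStationaryPoint_of_forall_le {F : Param p → ℝ} (hF : Differentiable ℝ F) {x : Param p}
    (hx : x ∈ closure Θ) (hle : ∀ y ∈ Θ, ‖y - x‖ ≤ 1 → -dirDeriv F x (y - x) ≤ 0) :
    IsStationaryPoint Θ F x := by
  have hbdd : (0 : ℝ) ∈ upperBounds (descentRates Θ F x) := by
    rintro a ⟨y, hy, hyx, rfl⟩
    exact hle y hy hyx
  refine ⟨hx, ⟨0, hbdd⟩, ?_⟩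
  refine le_antisymm ?_ ?_
  · exact Real.sSup_le (fun a ha => hbdd ha) le_rfl
  · refine le_of_forall_pos_le_add fun δ hδ => ?_
    set c := ‖gradient F x‖ with hc
    have hc0 : 0 ≤ c := norm_nonneg _
    obtain ⟨y, hy, hyx⟩ := Metric.mem_closure_iff.1 hx (min 1 (δ / (c + 1))) (by positivity)
    rw [dist_comm, dist_eq_norm] at hyx
    have h1 : -dirDeriv F x (y - x) ≤ optGap Θ F x :=
      le_csSup ⟨0, hbdd⟩ ⟨y, hy, hyx.le.trans (min_le_left _ _), rfl⟩
    have h2 : dirDeriv F x (y - x) ≤ c * ‖y - x‖ := by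
      rw [dirDeriv_eq_inner hF]
      exact real_inner_le_norm _ _
    have h3 : ‖y - x‖ * (c + 1) ≤ δ :=
      (le_div_iff₀ (by positivity)).1 (hyx.le.trans (min_le_right _ _))
    nlinarith [norm_nonneg (y - x)]

theorem IsDiminishingRadiusRun.isStationaryPoint
    (h : IsDiminishingRadiusRun Θ π f L r θ₀ v θ g) (hΘ : Convex ℝ Θ) (hπ : ∀ u, 0 ≤ π u)
    (hπ1 : ∑ u, π u = 1) (hf : RegularOn Θ f) (hs : Smooth L f) (hr : IsRadiusSequence r)
    (htop : ∀ u n, 1 ≤ n → returnTime v n u ≠ ⊤)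
    (hret : ∀ u, Summable fun n => r (n + 1) ^ 2 * ((returnTime v (n + 1) u).toNat : ℝ))
    {x : Param p} (hx : MapClusterPt x atTop θ) : IsStationaryPoint Θ (weighted π f) x := by
  have hG := weighted_mem_surrogates hπ hπ1 h.init_surrogate
  obtain ⟨B, hB⟩ := hf.exists_lowerBound hπ
  have hFd : Differentiable ℝ (weighted π f) := differentiable_weighted hs.differentiable
  have hdir := hf.hasDirDeriv_weighted (π := π)
  have hnonneg : ∀ x ∈ Θ, 0 ≤ optGap Θ (weighted π f) x := fun x hx =>
    optGap_nonneg hG hx (hdir x hx)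
  have hsum := h.summable_radius_mul_optGap hΘ hπ hπ1 hs hr hB hnonneg htop hret
  refine isStationaryPoint_of_forall_le hFd ?_ fun y hy hyx => ?_
  · refine mem_closure_iff_nhds.2 fun U hU => ?_
    obtain ⟨n, hn⟩ := (hx.frequently hU).exists
    exact ⟨θ n, hn, h.mem_feasible n⟩
  · by_contra! hpos
    -- Half of a positive descent rate at `x` bounds the gap from below at all feasible points near
    -- `x`, even if `x` itself is not feasible.
    have hev := eventually_lt_optGap hΘ hG hdir hy hyx
      (hasDirDeriv_of_differentiable hFd x _) (half_lt_self hpos)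
    rw [eventually_nhdsWithin_iff, Metric.eventually_nhds_iff] at hev
    obtain ⟨η, hη, hev⟩ := hev
    exact false_of_mapClusterPt_of_summable h.dist_le hr.tendsto_sum
      (fun n => hnonneg _ (h.mem_feasible n)) hsum hx (half_pos hpos) hη
      fun n hn => (hev hn (h.mem_feasible n)).le

end DiminishingRadius

end RMISO

end

theorem theorem2 {p : ℕ} {V Ω : Type*} [Fintype V] [MeasurableSpace V] [MeasurableSingletonClass V]
    [MeasurableSpace Ω] (P : Measure Ω) [IsProbabilityMeasure P]
    (Θ : Set (RMISO.Param p)) (hΘ : Convex ℝ Θ)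
    (π : V → ℝ) (hπ_nonneg : ∀ u, 0 ≤ π u) (hπ_sum : ∑ u, π u = 1)
    (f : V → RMISO.Param p → ℝ) (hf : RMISO.RegularOn Θ f)
    (L : ℝ≥0) (θ₀ : RMISO.Param p)
    (v : ℕ → Ω → V) (hv : ∀ n, Measurable (v n))
    (θ : ℕ → Ω → RMISO.Param p) (hθ : ∀ n, Measurable (θ n))
    (g : ℕ → Ω → V → RMISO.Param p → ℝ)
    (hrec : RMISO.IsRecurrent P v θ) :
    (∀ μ ρ : ℝ, 0 ≤ μ → 0 ≤ ρ → 0 < ρ + μ →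
      (∀ᵐ ω ∂P, RMISO.IsDynamicProxRun Θ π f L μ ρ θ₀
        (fun n => v n ω) (fun n => θ n ω) (fun n => g n ω)) →
      (∀ x ∈ Θ, BddAbove (RMISO.descentRates Θ (RMISO.weighted π f) x)) ∧
      (∀ n, Integrable (fun ω => RMISO.optGap Θ (RMISO.weighted π f) (θ n ω)) P) ∧
      (∀ n, Integrable (fun ω => RMISO.optGap Θ (RMISO.weighted π f) (θ n ω) ^ 2) P) ∧
      Tendsto (fun n => ∫ ω, RMISO.optGap Θ (RMISO.weighted π f) (θ n ω) ∂P) atTop (𝓝 0) ∧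
      Tendsto (fun n => ∫ ω, RMISO.optGap Θ (RMISO.weighted π f) (θ n ω) ^ 2 ∂P)
        atTop (𝓝 0)) ∧
    (∀ r : ℕ → ℝ, RMISO.IsRadiusSequence r → RMISO.Smooth L f →
      (∀ᵐ ω ∂P, RMISO.IsDiminishingRadiusRun Θ π f L r θ₀
        (fun n => v n ω) (fun n => θ n ω) (fun n => g n ω)) →
      ∀ᵐ ω ∂P, ∀ x : RMISO.Param p, MapClusterPt x atTop (fun n => θ n ω) →
        RMISO.IsStationaryPoint Θ (RMISO.weighted π f) x) := by
  refine ⟨fun μ ρ hμ hρ hρμ hrun =>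
    RMISO.dynamicProx_optGap_tendsto hΘ hπ_nonneg hπ_sum hf hv hθ hrec hμ hρ hρμ hrun,
    fun r hr hs hrun => ?_⟩
  filter_upwards [hrun, hrec.ae_returnTime_ne_top hv hθ,
    hrec.ae_summable_returnTime hv hθ (fun n => sq_nonneg (r (n + 1))) hr.summable_succ_sq]
    with ω hω htop hret x hx
  exact hω.isStationaryPoint hΘ hπ_nonneg hπ_sum hf hs hr htop hret hx
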